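/- Let $\mathbb{R}^3_\pm=\{x\in\mathbb{R}^3:\pm x_3>0\}$, $x_h=(x_1,x_2)$, $\Delta_h=\partial_1^2+\partial_2^2$, and let $\gamma_\pm:W^{1,2}(\mathbb{R}^3_\pm)\to L^2(\mathbb{R}^2)$ be the trace operators on $\{x_3=0\}$. Let $\kappa_A,\kappa_B,\tilde\kappa_S,\alpha_S,\beta>0$ and $0<T<\infty$. Let $H=L^2(\mathbb{R}^3_+)\times L^2(\mathbb{R}^3_-)\times L^2(\mathbb{R}^2)$ (complex-valued functions) with its Hilbert norm $\|f\|_H=(\|f_A\|_{L^2}^2+\|f_B\|_{L^2}^2+\|f_S\|_{L^2}^2)^{1/2}$ for $f=(f_A,f_B,f_S)$. Let $L$ be the operator in $H$ given by $$Lf=(-\kappa_A\Delta f_A,\,-\kappa_B\Delta f_B,\,-\tilde\kappa_S\Delta_h f_S),$$ $$D(L)=[W^{1,2}_0\cap W^{2,2}](\mathbb{R}^3_+)\times[W^{1,2}_0\cap W^{2,2}](\mathbb{R}^3_-)\times W^{2,2}(\mathbb{R}^2).$$ Let $X_T$ be the set of $\varphi\in C([0,T);H)$, with weak time derivative $d\varphi/dt\in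 L^2(0,T;H)$ and with $\varphi(t)\in D(L)$ for a.e. $t\in(0,T)$, such that $$\|\varphi\|_{X_T}=\sup_{0\le t<T}\|\varphi(t)\|_H+\|d\varphi/dt\|_{L^2(0,T;H)}+\|L\varphi\|_{L^2(0,T;H)}<\infty .$$ For $v=(v_A,v_B,v_S)\in X_T$ put $F(v)=(F_1(v),F_2(v),F_3(v))$, where $$F_1(v)=\Big(-\frac{dv_S}{dt}+\kappa_A\Delta_h v_S+\beta^2\kappa_A v_S\Big)e^{-\beta x_3},\qquad F_2(v)=\Big(-\frac{dv_S}{dt}+\kappa_B\Delta_h v_S+\beta^2\kappa_B v_S\Big)e^{\beta x_3},$$ $$F_3(v)=\frac{\kappa_A}{\alpha_S}\gamma_+[\partial_3v_A]-\frac{\kappa_B}{\alpha_S}\gamma_-[\partial_3v_B]-\frac{\beta}{\alpha_S}(\kappa_A+\kappa_B)v_S .$$ **Lemma.** Let $v_0\in H$ and let $v_\sharp,v_\flat\in X_T\cap\big(L^2((0,T)\times\mathbb{R}^3_+)\times L^2((0,T)\times\mathbb{R}^3_-)\times L^2((0,T)\times\mathbb{R}^2)\big)$ both satisfy $$\frac{d}{dt}v+Lv=F(v)\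 \text{ in } H \text{ for a.e. } t\in(0,T),\qquad v|_{t=0}=v_0 .$$ Then $v_\sharp(t)=v_\flat(t)$ in $H$ for all $t\in[0,T)$. -/

import Mathlib

open MeasureTheory Filter Topology Set
open scoped ContDiff

noncomputable section

namespace TwoPhaseHeat

/-! ### Domains and the spaces `L²(Ω)` -/

/-- Euclidean space `ℝⁿ`. -/
abbrev E (n : ℕ) : Type := EuclideanSpace ℝ (Fin n)

/-- The upper half space `ℝ³₊ = {x₃ > 0}` (coordinates are indexed by `0, 1, 2`). -/
abbrev upper : Set (E 3) := {x | 0 < x 2}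

/-- The lower half space `ℝ³₋ = {x₃ < 0}`. -/
abbrev lower : Set (E 3) := {x | x 2 < 0}

/-- The interface, identified with the plane `ℝ²`. -/
abbrev plane : Set (E 2) := Set.univ

/-- The horizontal part `x_h = (x₁, x₂)` of `x ∈ ℝ³`. -/
def horiz (x : E 3) : E 2 := !₂[x 0, x 1]

/-- The point `(y₁, y₂, 0)` of the interface in `ℝ³`. -/
def onInterface (y : E 2) : E 3 := !₂[y 0, y 1, 0]

/-- The complex Hilbert space `L²(Ω)` with respect to Lebesgue measure. -/
abbrev L2 {n : ℕ} (Ω : Set (E n)) : Type := Lp ℂ 2 (volume.restrict Ω)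

/-! ### Weak derivatives and Sobolev spaces -/

/-- `g = ∂ᵢ f` in the sense of distributions on `Ω`: `∫_Ω f ∂ᵢφ = - ∫_Ω g φ` for all
`φ ∈ C_c^∞(Ω)`. -/
def HasWeakPartial {n : ℕ} (Ω : Set (E n)) (i : Fin n) (f g : L2 Ω) : Prop :=
  ∀ φ : E n → ℝ, ContDiff ℝ ∞ φ → HasCompactSupport φ → tsupport φ ⊆ Ω →
    ∫ x in Ω, fderiv ℝ φ x (EuclideanSpace.single i 1) • f x = - ∫ x in Ω, φ x • g x

open Classical in
/-- The weak derivative `∂ᵢ f ∈ L²(Ω)` (and `0` if `f` has no weak derivative in `L²(Ω)`). -/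
def weakPartial {n : ℕ} (Ω : Set (E n)) (i : Fin n) (f : L2 Ω) : L2 Ω :=
  if h : ∃ g : L2 Ω, HasWeakPartial Ω i f g then h.choose else 0

/-- `f ∈ W^{1,2}(Ω)`. -/
def MemW1 {n : ℕ} (Ω : Set (E n)) (f : L2 Ω) : Prop :=
  ∀ i : Fin n, ∃ g : L2 Ω, HasWeakPartial Ω i f g

/-- `f ∈ W^{2,2}(Ω)`. -/
def MemW2 {n : ℕ} (Ω : Set (E n)) (f : L2 Ω) : Prop :=
  MemW1 Ω f ∧ ∀ i : Fin n, MemW1 Ω (weakPartial Ω i f)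

/-- The Laplacian `Δ f = ∑ᵢ ∂ᵢ ∂ᵢ f`, for `f ∈ W^{2,2}(Ω)`. -/
def laplacian {n : ℕ} (Ω : Set (E n)) (f : L2 Ω) : L2 Ω :=
  ∑ i : Fin n, weakPartial Ω i (weakPartial Ω i f)

/-- The (restrictions to `Ω` of the) `C¹` functions `φ k` converge to `f` in `W^{1,2}(Ω)`. -/
def TendstoW1 {n : ℕ} (Ω : Set (E n)) (φ : ℕ → E n → ℂ) (f : L2 Ω) : Prop :=
  Tendsto (fun k => eLpNorm (fun x => φ k x - f x) 2 (volume.restrict Ω)) atTop (𝓝 0) ∧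
  ∀ i : Fin n, Tendsto (fun k => eLpNorm
    (fun x => fderiv ℝ (φ k) x (EuclideanSpace.single i 1) - weakPartial Ω i f x) 2
    (volume.restrict Ω)) atTop (𝓝 0)

/-- `f ∈ W_0^{1,2}(Ω)`, the closure of `C_c^∞(Ω)` in `W^{1,2}(Ω)`. -/
def MemW10 {n : ℕ} (Ω : Set (E n)) (f : L2 Ω) : Prop :=
  MemW1 Ω f ∧ ∃ φ : ℕ → E n → ℂ,
    (∀ k, ContDiff ℝ ∞ (φ k) ∧ HasCompactSupport (φ k) ∧ tsupport (φ k) ⊆ Ω) ∧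
    TendstoW1 Ω φ f

/-- The graph of the trace operator `γ : W^{1,2}(Ω) → L²(ℝ²)` for a half space `Ω ⊆ ℝ³` bounded
by `{x₃ = 0}`: the continuous extension of `φ ↦ φ(·, ·, 0)` from (restrictions to `Ω` of)
functions `φ ∈ C_c^∞(ℝ³)`. -/
def HasTrace (Ω : Set (E 3)) (f : L2 Ω) (h : L2 plane) : Prop :=
  MemW1 Ω f ∧ ∃ φ : ℕ → E 3 → ℂ,
    (∀ k, ContDiff ℝ ∞ (φ k) ∧ HasCompactSupport (φ k)) ∧
    TendstoW1 Ω φ f ∧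
    Tendsto (fun k => eLpNorm (fun y => φ k (onInterface y) - h y) 2 (volume.restrict plane))
      atTop (𝓝 0)

open Classical in
/-- The trace operator; `trace upper = γ₊` and `trace lower = γ₋` on `W^{1,2}`. -/
def trace (Ω : Set (E 3)) (f : L2 Ω) : L2 plane :=
  if h : ∃ g : L2 plane, HasTrace Ω f g then h.choose else 0

/-! ### The Hilbert space `H` and the operator `L` -/

/-- `H = L²(ℝ³₊) × L²(ℝ³₋) × L²(ℝ²)` with its Hilbert norm. -/
abbrev H : Type := WithLp 2 (L2 upper × WithLp 2 (L2 lower × L2 plane))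

/-- The component `f_A ∈ L²(ℝ³₊)`. -/
def H.A (f : H) : L2 upper := f.fst

/-- The component `f_B ∈ L²(ℝ³₋)`. -/
def H.B (f : H) : L2 lower := f.snd.fst

/-- The component `f_S ∈ L²(ℝ²)`. -/
def H.S (f : H) : L2 plane := f.snd.snd

/-- The element of `H` with given components. -/
def H.mk (a : L2 upper) (b : L2 lower) (s : L2 plane) : H :=
  WithLp.toLp 2 (a, WithLp.toLp 2 (b, s))

/-- `D(L) = [W_0^{1,2} ∩ W^{2,2}](ℝ³₊) × [W_0^{1,2} ∩ W^{2,2}](ℝ³₋) × W^{2,2}(ℝ²)`. -/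
def MemDomL (f : H) : Prop :=
  (MemW10 upper (H.A f) ∧ MemW2 upper (H.A f)) ∧
  (MemW10 lower (H.B f) ∧ MemW2 lower (H.B f)) ∧
  MemW2 plane (H.S f)

/-- `L f = (-κ_A Δ f_A, -κ_B Δ f_B, -κ_S Δ_h f_S)`, for `f ∈ D(L)`; here `κ_S` is the constant
written with a tilde on paper (the conductivity divided by `α_S`). -/
def L (κA κB κS : ℝ) (f : H) : H :=
  H.mk (-(κA • laplacian upper (H.A f))) (-(κB • laplacian lower (H.B f)))
    (-(κS • laplacian plane (H.S f)))

/-! ### Functions of time and the space `X_T` -/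

/-- `w = dv/dt` in the sense of `H`-valued distributions on `(0,T)`, with `w ∈ L²(0,T;H)`. -/
def HasL2TimeDeriv (T : ℝ) (v w : ℝ → H) : Prop :=
  MemLp w 2 (volume.restrict (Ioo 0 T)) ∧
  ∀ η : ℝ → ℝ, ContDiff ℝ ∞ η → HasCompactSupport η → tsupport η ⊆ Ioo 0 T →
    ∫ t in Ioo 0 T, deriv η t • v t = - ∫ t in Ioo 0 T, η t • w t

open Classical in
/-- The time derivative `dv/dt ∈ L²(0,T;H)` (unique up to null sets of times). -/
def timeDeriv (T : ℝ) (v : ℝ → H) : ℝ → H :=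
  if h : ∃ w : ℝ → H, HasL2TimeDeriv T v w then h.choose else 0

/-- `v ∈ X_T`: `v ∈ C([0,T);H)` and the three terms of its `X_T`-norm,
`sup_{0≤t<T} ‖v(t)‖_H`, `‖dv/dt‖_{L²(0,T;H)}` and `‖Lv‖_{L²(0,T;H)}`, are defined and finite. -/
structure MemX (κA κB κS T : ℝ) (v : ℝ → H) : Prop where
  continuousOn : ContinuousOn v (Ico 0 T)
  bounded : ∃ C : ℝ, ∀ t ∈ Ico 0 T, ‖v t‖ ≤ C
  exists_timeDeriv : ∃ w : ℝ → H, HasL2TimeDeriv T v w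
  mem_dom : ∀ᵐ t ∂(volume.restrict (Ioo 0 T)), MemDomL (v t)
  memLp_L : MemLp (fun t => L κA κB κS (v t)) 2 (volume.restrict (Ioo 0 T))

/-- A family `f(t) ∈ L²(Ω)` is given by a function in `L²((0,T) × Ω)`. -/
def MemJointL2 {n : ℕ} (T : ℝ) (Ω : Set (E n)) (f : ℝ → L2 Ω) : Prop :=
  ∃ u : ℝ × E n → ℂ,
    MemLp u 2 ((volume.restrict (Ioo 0 T)).prod (volume.restrict Ω)) ∧
    ∀ᵐ t ∂(volume.restrict (Ioo 0 T)), (fun x => u (t, x)) =ᵐ[volume.restrict Ω] f t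

/-- `v ∈ L²((0,T) × ℝ³_{+,-,0}) = L²((0,T) × ℝ³₊) × L²((0,T) × ℝ³₋) × L²((0,T) × ℝ²)`. -/
def MemL2TimeSpace (T : ℝ) (v : ℝ → H) : Prop :=
  MemJointL2 T upper (fun t => H.A (v t)) ∧
  MemJointL2 T lower (fun t => H.B (v t)) ∧
  MemJointL2 T plane (fun t => H.S (v t))

/-! ### The transformed system -/

/-- `F₁ = (-(w_S) + κ_A Δ_h v_S + β² κ_A v_S) e^{-β x₃}`, a function of `x ∈ ℝ³₊`;
here `w` stands for the value of `dv/dt`. -/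
def F₁ (κA β : ℝ) (v w : H) (x : E 3) : ℂ :=
  (-(H.S w (horiz x)) + κA * laplacian plane (H.S v) (horiz x)
    + β ^ 2 * κA * H.S v (horiz x)) * Real.exp (-β * x 2)

/-- `F₂ = (-(w_S) + κ_B Δ_h v_S + β² κ_B v_S) e^{β x₃}`, a function of `x ∈ ℝ³₋`. -/
def F₂ (κB β : ℝ) (v w : H) (x : E 3) : ℂ :=
  (-(H.S w (horiz x)) + κB * laplacian plane (H.S v) (horiz x)
    + β ^ 2 * κB * H.S v (horiz x)) * Real.exp (β * x 2)

/-- `F₃ = (κ_A/α_S) γ₊[∂₃ v_A] - (κ_B/α_S) γ₋[∂₃ v_B] - (β/α_S) (κ_A + κ_B) v_S`. -/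
def F₃ (κA κB αS β : ℝ) (v : H) : L2 plane :=
  (κA / αS) • trace upper (weakPartial upper 2 (H.A v))
    - (κB / αS) • trace lower (weakPartial lower 2 (H.B v))
    - (β / αS * (κA + κB)) • H.S v

/-- `dv/dt + L v = F(v)` in `H` (componentwise, as elements of `L²`), for a.e. time in `(0,T)`. -/
def SolvesEquation (κA κB κS αS β T : ℝ) (v : ℝ → H) : Prop :=
  ∀ᵐ t ∂(volume.restrict (Ioo 0 T)),
    H.A (timeDeriv T v t + L κA κB κS (v t))
      =ᵐ[volume.restrict upper] F₁ κA β (v t) (timeDeriv T v t) ∧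
    H.B (timeDeriv T v t + L κA κB κS (v t))
      =ᵐ[volume.restrict lower] F₂ κB β (v t) (timeDeriv T v t) ∧
    H.S (timeDeriv T v t + L κA κB κS (v t)) = F₃ κA κB αS β (v t)

/-- `v ∈ X_T ∩ L²((0,T) × ℝ³_{+,-,0})` is a strong solution of `dv/dt + L v = F(v)` on `(0,T)`
with `v(0) = v₀`. -/
structure IsStrongSolution (κA κB κS αS β T : ℝ) (v₀ : H) (v : ℝ → H) : Prop where
  memX : MemX κA κB κS T v
  memL2 : MemL2TimeSpace T v
  equation : SolvesEquation κA κB κS αS β T v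
  initial : v 0 = v₀

end TwoPhaseHeat

end

noncomputable section

namespace TwoPhaseHeat

/-! Undoing the lifting turns the system into a dissipative one. Put `u_A = v_A + v_S e^{-βx₃}` and
`u_B = v_B + v_S e^{βx₃}`. The forcing terms `F₁`, `F₂` then disappear: `u_A` and `u_B` solve the
heat equations in the two half spaces, both have trace `v_S`, and the `β`-term of `F₃` is exactly
what changes the fluxes of `v_A`, `v_B` into those of `u_A`, `u_B`. In the derivative of the energy
`½(‖u_A‖² + ‖u_B‖² + α_S‖v_S‖²)` the boundary terms from Green's formula cancel against `α_S ⟪F₃,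
v_S⟫`, and minus a sum of squared gradients remains. The system is linear, so this applies to the
difference of two solutions, whose energy starts at zero and hence stays zero. The map `undo` is
injective, so the difference itself vanishes.

Two analytic points carry this. In time, `eq_add_integral_of_weak_deriv` writes each solution as its
initial value plus the integral of its weak derivative, and `integral_eq_zero_of_inner_nonpos` makes
the energy argument rigorous through absolute continuity.

In space, Green's formula is needed for Sobolev functions. The closed subspace `sobolevGraph`
collects the limits of triples `(φ, ∇φ, φ ∘ ι)` of test functions. Green's identity holds for test
functions and is a closed condition, so it extends to this closure (`green_tangential`,
`green_vertical`). Elements of `W^{1,2}` are in the graph by mollification along an inward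
direction, elements of `W_0^{1,2}` with trace zero, and exponential liftings with trace `s`. Taking
`S = ∅` drops the trace component. These pieces meet in `inner_laplacian_add_expLift_le` and
`inner_undo_sub_nonpos`. -/

/-! ### Weak time derivatives and energy estimates -/

/-- A smooth step of width `1 / k` at `a`. -/
def step (k a t : ℝ) : ℝ := Real.smoothTransition (k * (t - a))

theorem contDiff_step (k a : ℝ) : ContDiff ℝ ∞ (step k a) :=
  Real.smoothTransition.contDiff.comp (contDiff_const.mul (contDiff_id.sub contDiff_const))

theorem step_of_le {k a t : ℝ} (hk : 0 < k) (h : t ≤ a) : step k a t = 0 :=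
  Real.smoothTransition.zero_of_nonpos (mul_nonpos_of_nonneg_of_nonpos hk.le (by linarith))

theorem step_of_ge {k a t : ℝ} (hk : 0 < k) (h : a + 1 / k ≤ t) : step k a t = 1 := by
  apply Real.smoothTransition.one_of_one_le
  have : 1 / k ≤ t - a := by linarith
  rw [div_le_iff₀ hk] at this
  linarith

/-- The step attains its global minimum at such `t`. This covers the end point `t = a`, where the
step is not locally constant. -/
theorem deriv_step_of_le {k a t : ℝ} (hk : 0 < k) (h : t ≤ a) : deriv (step k a) t = 0 := by
  apply IsLocalMin.deriv_eq_zero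
  refine Eventually.of_forall fun x => ?_
  rw [step_of_le hk h]
  exact Real.smoothTransition.nonneg _

theorem deriv_step_of_ge {k a t : ℝ} (hk : 0 < k) (h : a + 1 / k ≤ t) :
    deriv (step k a) t = 0 := by
  apply IsLocalMax.deriv_eq_zero
  refine Eventually.of_forall fun x => ?_
  rw [step_of_ge hk h]
  exact Real.smoothTransition.le_one _

theorem deriv_step_nonneg {k a : ℝ} (hk : 0 < k) (t : ℝ) : 0 ≤ deriv (step k a) t := by
  apply Monotone.deriv_nonneg
  intro x y hxy
  exact Real.smoothTransition.monotone (mul_le_mul_of_nonneg_left (by linarith) hk.le)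

section TimeDerivative

variable {K : Type*} [NormedAddCommGroup K]

/-- The derivatives of the steps are nonnegative, have mass one and vanish outside `[a, a + 1/k]`,
so they form an approximate identity at `a` from the right. -/
theorem tendsto_integral_deriv_step_smul [NormedSpace ℝ K] [CompleteSpace K] {T a : ℝ}
    {v : ℝ → K} (hv : ContinuousOn v (Ico 0 T)) (ha : 0 < a) (haT : a < T) :
    Tendsto (fun k : ℕ => ∫ t in Ioo 0 T, deriv (step k a) t • v t) atTop (𝓝 (v a)) := by
  rw [Metric.tendsto_atTop]
  intro ε hε
  have hva : ContinuousAt v a := hv.continuousAt (Ico_mem_nhds ha haT)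
  obtain ⟨δ, hδ, hvδ⟩ := Metric.continuousAt_iff.1 hva (ε / 2) (half_pos hε)
  -- For `k ≥ N` the interval `[a, a + 1/k]` lies both in the `δ`-neighbourhood of `a` and in `(0,
  -- T)`.
  obtain ⟨N, hN⟩ := exists_nat_gt (1 / min δ (T - a))
  have hmin : 0 < min δ (T - a) := lt_min hδ (by linarith)
  refine ⟨N, fun k hk => ?_⟩
  have hNpos : (0 : ℝ) < N := (by positivity : (0 : ℝ) < 1 / min δ (T - a)).trans hN
  have hkN : (N : ℝ) ≤ k := by exact_mod_cast hk
  have hkpos : (0 : ℝ) < k := hNpos.trans_le hkN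
  have hk1 : 1 / (k : ℝ) < min δ (T - a) := by
    rw [div_lt_iff₀ hkpos]
    rw [div_lt_iff₀ hmin] at hN
    nlinarith
  have hkδ := hk1.trans_le (min_le_left _ _)
  have hkT := hk1.trans_le (min_le_right _ _)
  have hk0 : 0 < 1 / (k : ℝ) := by positivity
  have hle : a ≤ a + 1 / k := by linarith
  have hsub : Ioc a (a + 1 / k) ⊆ Ioo 0 T := fun t ht => ⟨ha.trans ht.1, by linarith [ht.2]⟩
  have hcont : Continuous (deriv (step k a)) :=
    (contDiff_step k a).continuous_deriv (by simp)
  have h1 : ∫ t in Ioo 0 T, deriv (step k a) t • v t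
      = ∫ t in a..(a + 1 / k), deriv (step k a) t • v t := by
    rw [intervalIntegral.integral_of_le hle]
    apply setIntegral_eq_of_subset_of_forall_sdiff_eq_zero measurableSet_Ioo hsub
    intro t ht
    have : deriv (step k a) t = 0 := by
      by_cases h : t ≤ a
      · exact deriv_step_of_le hkpos h
      · refine deriv_step_of_ge hkpos ?_
        by_contra h'
        exact ht.2 ⟨not_le.1 h, (not_le.1 h').le⟩
    rw [this, zero_smul]
  have h2 : ∫ t in a..(a + 1 / k), deriv (step k a) t = 1 := by
    rw [intervalIntegral.integral_deriv_eq_sub]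
    · rw [step_of_le hkpos le_rfl, step_of_ge hkpos le_rfl, sub_zero]
    · intro x _
      exact (contDiff_step k a).differentiable (by simp) x
    · exact hcont.intervalIntegrable _ _
  have hvc : ContinuousOn v (uIcc a (a + 1 / k)) := by
    rw [uIcc_of_le hle]
    exact hv.mono fun t ht => ⟨by linarith [ht.1], by linarith [ht.2]⟩
  have h3 : v a = ∫ t in a..(a + 1 / k), deriv (step k a) t • v a := by
    rw [intervalIntegral.integral_smul_const, h2, one_smul]
  rw [h1, dist_eq_norm]
  conv_lhs => rw [h3]
  rw [← intervalIntegral.integral_sub]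
  rotate_left
  · exact (hcont.continuousOn.smul hvc).intervalIntegrable
  · exact (hcont.smul continuous_const).intervalIntegrable _ _
  have h4 := intervalIntegral.norm_integral_le_of_norm_le (μ := volume) hle
    (f := fun t => deriv (step k a) t • v t - deriv (step k a) t • v a)
    (g := fun t => deriv (step k a) t * (ε / 2)) (Eventually.of_forall fun t ht => by
      rw [← smul_sub, norm_smul, Real.norm_of_nonneg (deriv_step_nonneg hkpos t)]
      refine mul_le_mul_of_nonneg_left ?_ (deriv_step_nonneg hkpos t)
      have := hvδ (x := t) (by
        rw [Real.dist_eq, abs_of_pos (by linarith [ht.1])]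
        linarith [ht.2])
      rw [dist_eq_norm] at this
      exact this.le) ((hcont.mul continuous_const).intervalIntegrable _ _)
  rw [intervalIntegral.integral_mul_const, h2, one_mul] at h4
  linarith

theorem tendsto_step (a t : ℝ) :
    Tendsto (fun k : ℕ => step k a t) atTop (𝓝 (if a < t then 1 else 0)) := by
  split_ifs with h
  · obtain ⟨N, hN⟩ := exists_nat_gt (1 / (t - a))
    refine tendsto_const_nhds.congr' ?_
    filter_upwards [eventually_ge_atTop N] with k hk
    have hta : 0 < t - a := by linarith
    have hkN : (N : ℝ) ≤ k := by exact_mod_cast hk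
    refine (Real.smoothTransition.one_of_one_le ?_).symm
    rw [div_lt_iff₀ hta] at hN
    nlinarith
  · refine tendsto_const_nhds.congr fun k => ?_
    exact (Real.smoothTransition.zero_of_nonpos
      (mul_nonpos_of_nonneg_of_nonpos (Nat.cast_nonneg _) (by linarith [not_lt.1 h]))).symm

theorem abs_step_sub_step_le_one (k a b t : ℝ) : |step k a t - step k b t| ≤ 1 := by
  have h1 := Real.smoothTransition.nonneg (k * (t - a))
  have h2 := Real.smoothTransition.nonneg (k * (t - b))
  have h3 := Real.smoothTransition.le_one (k * (t - a))
  have h4 := Real.smoothTransition.le_one (k * (t - b))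
  rw [abs_le]
  constructor <;> simp only [step] <;> linarith

/-- A continuous function with an integrable weak derivative on `(0,T)` is a primitive of it. -/
theorem sub_eq_integral_of_weak_deriv [NormedSpace ℝ K] [CompleteSpace K] {T : ℝ} {v w : ℝ → K}
    (hv : ContinuousOn v (Ico 0 T)) (hw : IntegrableOn w (Ioo 0 T))
    (h : ∀ η : ℝ → ℝ, ContDiff ℝ ∞ η → HasCompactSupport η → tsupport η ⊆ Ioo 0 T →
      ∫ t in Ioo 0 T, deriv η t • v t = - ∫ t in Ioo 0 T, η t • w t)
    {a b : ℝ} (ha : 0 < a) (hab : a ≤ b) (hb : b < T) :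
    v b - v a = ∫ t in a..b, w t := by
  have haT := hab.trans_lt hb
  -- Nothing is assumed about the integrability of `v` near `T`; continuity on a compact subinterval
  -- suffices because the weights vanish outside it.
  have hvloc : ∀ η : ℝ → ℝ, Continuous η → (∀ t ∉ Icc a ((b + T) / 2), η t = 0) →
      IntegrableOn (fun t => η t • v t) (Ioo 0 T) := by
    intro η hη h0
    have h1 : IntegrableOn (fun t => η t • v t) (Icc a ((b + T) / 2)) :=
      (hη.continuousOn.smul (hv.mono fun t ht => ⟨by linarith [ht.1],
        by linarith [ht.2]⟩)).integrableOn_Icc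
    exact h1.of_forall_sdiff_eq_zero measurableSet_Ioo fun t ht => by rw [h0 t ht.2, zero_smul]
  have lim1 := (tendsto_integral_deriv_step_smul hv ha haT).sub
    (tendsto_integral_deriv_step_smul hv (ha.trans_le hab) hb)
  have lim2 : Tendsto (fun k : ℕ => ∫ t in Ioo 0 T, (step k a t - step k b t) • w t) atTop
      (𝓝 (∫ t in Ioo 0 T, (if t ∈ Ioc a b then (1 : ℝ) else 0) • w t)) := by
    refine tendsto_integral_of_dominated_convergence (fun t => ‖w t‖) ?_ hw.norm ?_ ?_
    · intro k
      exact (((contDiff_step k a).continuous.sub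
        (contDiff_step k b).continuous).aestronglyMeasurable).smul hw.aestronglyMeasurable
    · intro k
      refine Eventually.of_forall fun t => ?_
      rw [norm_smul, Real.norm_eq_abs]
      exact mul_le_of_le_one_left (norm_nonneg _) (abs_step_sub_step_le_one _ _ _ _)
    · refine Eventually.of_forall fun t => ?_
      refine Tendsto.smul_const ?_ _
      convert (tendsto_step a t).sub (tendsto_step b t) using 2
      simp only [mem_Ioc]
      split_ifs <;> grind
  have hlim : ∫ t in Ioo 0 T, (if t ∈ Ioc a b then (1 : ℝ) else 0) • w t
      = ∫ t in a..b, w t := by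
    rw [intervalIntegral.integral_of_le hab]
    have : (fun t => (if t ∈ Ioc a b then (1 : ℝ) else 0) • w t) = (Ioc a b).indicator w := by
      ext t
      by_cases ht : t ∈ Ioc a b <;> simp [ht]
    rw [this, setIntegral_indicator measurableSet_Ioc, inter_eq_right.2]
    exact fun t ht => ⟨ha.trans ht.1, ht.2.trans_lt hb⟩
  rw [hlim] at lim2
  -- The weak derivative is tested with the difference of the steps at `a` and `b`, a smooth
  -- approximation of the indicator of `(a, b]`. For large `k` its support stays below `(b + T) / 2
  -- < T`.
  have key : ∀ᶠ k : ℕ in atTop,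
      (∫ t in Ioo 0 T, deriv (step k a) t • v t) - (∫ t in Ioo 0 T, deriv (step k b) t • v t)
        = - ∫ t in Ioo 0 T, (step k a t - step k b t) • w t := by
    obtain ⟨N, hN⟩ := exists_nat_gt (1 / ((T - b) / 2))
    filter_upwards [eventually_ge_atTop N] with k hk
    have hTb : 0 < (T - b) / 2 := by linarith
    have hNpos : (0 : ℝ) < N := (by positivity : (0 : ℝ) < 1 / ((T - b) / 2)).trans hN
    have hkN : (N : ℝ) ≤ k := by exact_mod_cast hk
    have hkpos : (0 : ℝ) < k := hNpos.trans_le hkN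
    have hk1 : 1 / (k : ℝ) < (T - b) / 2 := by
      rw [div_lt_iff₀ hkpos]
      rw [div_lt_iff₀ hTb] at hN
      nlinarith
    have hd : ∀ c, a ≤ c → c ≤ b → ∀ t ∉ Icc a ((b + T) / 2), deriv (step k c) t = 0 := by
      intro c hc hcb t ht
      by_cases h : t < a
      · exact deriv_step_of_le hkpos (by linarith)
      · refine deriv_step_of_ge hkpos ?_
        by_contra h'
        exact ht ⟨not_lt.1 h, by linarith [not_le.1 h']⟩
    have hda := hvloc _ ((contDiff_step k a).continuous_deriv (by simp)) (hd a le_rfl hab)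
    have hdb := hvloc _ ((contDiff_step k b).continuous_deriv (by simp)) (hd b hab le_rfl)
    have hsupp : tsupport (fun t => step k a t - step k b t) ⊆ Icc a ((b + T) / 2) := by
      refine closure_minimal ?_ isClosed_Icc
      intro t ht
      by_contra h'
      apply ht
      by_cases h : t < a
      · simp [step_of_le hkpos h.le, step_of_le hkpos (h.le.trans hab)]
      · have : (b + T) / 2 < t := by
          by_contra h2
          exact h' ⟨not_lt.1 h, not_lt.1 h2⟩
        simp [step_of_ge hkpos (show a + 1 / k ≤ t by linarith),
          step_of_ge hkpos (show b + 1 / k ≤ t by linarith)]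
    rw [← integral_sub hda hdb, ← h (fun t => step k a t - step k b t)
      ((contDiff_step k a).sub (contDiff_step k b))
      (isCompact_Icc.of_isClosed_subset (isClosed_tsupport _) hsupp)
      (hsupp.trans fun t ht => ⟨ha.trans_le ht.1, by linarith [ht.2]⟩)]
    refine integral_congr_ae (Eventually.of_forall fun t => ?_)
    simp only
    rw [← sub_smul]
    congr 1
    exact (deriv_sub ((contDiff_step k a).differentiable (by simp) t)
      ((contDiff_step k b).differentiable (by simp) t)).symm
  have := tendsto_nhds_unique (lim1.congr' key) lim2.neg
  rw [← neg_sub, this, neg_neg]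

/-- Test functions do not see the time `0`. The identity on `[a, b]` with `a > 0` extends to `a = 0`
since both `v` and the primitive of `w` are continuous there. -/
theorem eq_add_integral_of_weak_deriv [NormedSpace ℝ K] [CompleteSpace K] {T : ℝ} {v w : ℝ → K}
    (hv : ContinuousOn v (Ico 0 T)) (hw : IntegrableOn w (Ioo 0 T))
    (h : ∀ η : ℝ → ℝ, ContDiff ℝ ∞ η → HasCompactSupport η → tsupport η ⊆ Ioo 0 T →
      ∫ t in Ioo 0 T, deriv η t • v t = - ∫ t in Ioo 0 T, η t • w t)
    {b : ℝ} (hb : b ∈ Ico 0 T) :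
    v b = v 0 + ∫ t in (0 : ℝ)..b, w t := by
  rcases hb.1.eq_or_lt with rfl | hb0
  · simp
  have hwi : IntegrableOn w (Icc 0 b) := by
    rw [integrableOn_Icc_iff_integrableOn_Ioc]
    exact hw.mono_set fun t ht => ⟨ht.1, ht.2.trans_lt hb.2⟩
  have hIc : ContinuousOn (fun a => ∫ t in (0 : ℝ)..a, w t) (Icc 0 b) := by
    rw [← uIcc_of_le hb0.le] at hwi ⊢
    exact intervalIntegral.continuousOn_primitive_interval hwi
  have hc : ContinuousOn (fun a => v a - ∫ t in (0 : ℝ)..a, w t) (Icc 0 b) :=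
    (hv.mono fun t ht => ⟨ht.1, ht.2.trans_lt hb.2⟩).sub hIc
  have hconst : ∀ a ∈ Ioc 0 b, v a - ∫ t in (0 : ℝ)..a, w t = v b - ∫ t in (0 : ℝ)..b, w t := by
    intro a ha
    have h1 := sub_eq_integral_of_weak_deriv hv hw h ha.1 ha.2 hb.2
    have h2 := intervalIntegral.integral_add_adjacent_intervals (μ := volume) (f := w)
      (a := 0) (b := a) (c := b)
      ((intervalIntegrable_iff_integrableOn_Icc_of_le ha.1.le).2
        (hwi.mono_set (Icc_subset_Icc_right ha.2)))
      ((intervalIntegrable_iff_integrableOn_Icc_of_le ha.2).2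
        (hwi.mono_set (Icc_subset_Icc_left ha.1.le)))
    rw [← h2, ← h1]
    abel
  have hlim := (hc 0 ⟨le_rfl, hb0.le⟩).tendsto.mono_left
    (nhdsWithin_mono 0 (Ioc_subset_Icc_self : Ioc 0 b ⊆ Icc 0 b))
  have : (𝓝[Ioc 0 b] (0 : ℝ)).NeBot := by
    rw [nhdsWithin_Ioc_eq_nhdsGT hb0]
    infer_instance
  have h0 := tendsto_nhds_unique hlim (tendsto_const_nhds.congr'
    (eventually_nhdsWithin_of_forall fun a ha => (hconst a ha).symm))
  simp only [intervalIntegral.integral_same, sub_zero] at h0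
  rw [h0]
  abel

/-- If `u(t) = ∫₀ᵗ w` and `⟪w, u⟫ ≤ 0` almost everywhere, then `u = 0`. -/
theorem integral_eq_zero_of_inner_nonpos [InnerProductSpace ℝ K] [CompleteSpace K] {b : ℝ}
    (hb : 0 ≤ b) {w : ℝ → K} (hw : IntervalIntegrable w volume 0 b)
    (h : ∀ᵐ t, t ∈ Ioo 0 b → inner ℝ (∫ s in (0 : ℝ)..t, w s) (w t) ≤ 0) :
    ∫ s in (0 : ℝ)..b, w s = 0 := by
  set u : ℝ → K := fun t => ∫ s in (0 : ℝ)..t, w s with hu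
  have hwi : ∀ s ∈ uIcc 0 b, ∀ t ∈ uIcc 0 b, IntervalIntegrable w volume s t := fun s hs t ht =>
    hw.mono_set (uIcc_subset_uIcc hs ht)
  -- Increments of `u` are dominated by those of the real primitive `N` of `‖w‖`, which transfers
  -- absolute continuity to `‖u‖²`.
  have hN := hw.norm.absolutelyContinuousOnInterval_intervalIntegral (c := 0) (by simp)
  set N : ℝ → ℝ := fun t => ∫ s in (0 : ℝ)..t, ‖w s‖ with hNdef
  have hsub : ∀ s ∈ uIcc 0 b, ∀ t ∈ uIcc 0 b, ‖u s - u t‖ ≤ |N s - N t| := by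
    intro s hs t ht
    rw [hu, hNdef]
    simp only
    rw [intervalIntegral.integral_interval_sub_left (hwi 0 (by simp) s hs) (hwi 0 (by simp) t ht),
      intervalIntegral.integral_interval_sub_left (hwi 0 (by simp) s hs).norm
        (hwi 0 (by simp) t ht).norm]
    exact intervalIntegral.norm_integral_le_abs_integral_norm
  have huc : ContinuousOn u (uIcc 0 b) :=
    intervalIntegral.continuousOn_primitive_interval' hw (by simp)
  obtain ⟨M, hM⟩ := isCompact_uIcc.exists_bound_of_continuousOn huc
  have hM0 : 0 ≤ M := (norm_nonneg _).trans (hM 0 (by simp))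
  have hAC : AbsolutelyContinuousOnInterval (fun t => ‖u t‖ ^ 2) 0 b := by
    rw [absolutelyContinuousOnInterval_iff] at hN ⊢
    intro ε hε
    -- On the ball of radius `M` the squared norm has Lipschitz constant `2M`; the extra `1` keeps
    -- the quotient defined and the final inequality strict when `M = 0`.
    obtain ⟨δ, hδ, hδ'⟩ := hN (ε / (2 * M + 1)) (by positivity)
    refine ⟨δ, hδ, fun E hE hEδ => ?_⟩
    have hmem := hE
    rw [AbsolutelyContinuousOnInterval.disjWithin, Set.mem_ofPred_eq] at hmem
    calc ∑ i ∈ Finset.range E.1, dist (‖u (E.2 i).1‖ ^ 2) (‖u (E.2 i).2‖ ^ 2)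
        ≤ ∑ i ∈ Finset.range E.1, (2 * M) * dist (N (E.2 i).1) (N (E.2 i).2) := by
          refine Finset.sum_le_sum fun i hi => ?_
          obtain ⟨h1, h2⟩ := hmem.1 i hi
          have h3 := hsub _ h1 _ h2
          rw [Real.dist_eq, Real.dist_eq, sq_sub_sq, abs_mul, abs_of_nonneg (by positivity)]
          refine mul_le_mul (by linarith [hM _ h1, hM _ h2])
            ((abs_norm_sub_norm_le _ _).trans h3) (abs_nonneg _) (by positivity)
      _ = (2 * M) * ∑ i ∈ Finset.range E.1, dist (N (E.2 i).1) (N (E.2 i).2) := by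
          rw [Finset.mul_sum]
      _ ≤ (2 * M) * (ε / (2 * M + 1)) := by
          exact mul_le_mul_of_nonneg_left (hδ' E hE hEδ).le (by positivity)
      _ < ε := by
          rw [← mul_div_assoc, div_lt_iff₀ (by positivity)]
          nlinarith
  -- The fundamental theorem for absolutely continuous functions applies, and by Lebesgue
  -- differentiation the derivative is `2⟪u, w⟫` almost everywhere.
  have hFTC := hAC.integral_deriv_eq_sub
  have hder : ∀ᵐ t, t ∈ Ioo 0 b → deriv (fun t => ‖u t‖ ^ 2) t ≤ 0 := by
    filter_upwards [h, hw.ae_hasDerivAt_integral] with t ht1 ht2 ht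
    have ht' : t ∈ uIcc 0 b := by
      rw [uIcc_of_le hb]; exact Ioo_subset_Icc_self ht
    have := (ht2 ht' 0 (by simp)).norm_sq
    rw [this.deriv]
    linarith [ht1 ht]
  have hle : ∫ t in (0 : ℝ)..b, deriv (fun t => ‖u t‖ ^ 2) t ≤ 0 := by
    rw [intervalIntegral.integral_of_le hb, integral_Ioc_eq_integral_Ioo]
    refine integral_nonpos_of_ae ?_
    exact (ae_restrict_iff' measurableSet_Ioo).2 hder
  rw [hFTC] at hle
  have hu0 : u 0 = 0 := by simp [hu]
  rw [hu0] at hle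
  have : ‖u b‖ ^ 2 ≤ 0 := by simpa using hle
  exact norm_eq_zero.1 (pow_eq_zero_iff two_ne_zero |>.1 (le_antisymm this (sq_nonneg _)))

end TimeDerivative

/-! ### Mollification in `L²` -/

section Mollify

variable {n : ℕ}

/-- This is continuity of translations in `L²`, read off from the continuity of composition with a
continuous family of measure-preserving maps. -/
theorem exists_eLpNorm_translate_sub_le {f : E n → ℂ} (hf : MemLp f 2 volume) {ε : ENNReal}
    (hε : 0 < ε) : ∃ r > 0, ∀ t : E n, ‖t‖ < r →
      eLpNorm (fun x => f (x - t) - f x) 2 volume ≤ ε := by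
  let g : C(E n, C(E n, E n)) := ContinuousMap.curry ⟨fun p : E n × E n => p.2 - p.1, by fun_prop⟩
  have hg : ∀ t, MeasurePreserving (g t) (volume : Measure (E n)) volume := fun t =>
    measurePreserving_sub_right volume t
  have hcont := (continuous_const (y := hf.toLp f)).compMeasurePreservingLp g.continuous hg
    (by simp)
  have h0 : Lp.compMeasurePreserving (g 0) (hg 0) (hf.toLp f) = hf.toLp f := by
    refine Lp.ext ((Lp.coeFn_compMeasurePreserving _ _).trans (Eventually.of_forall fun x => ?_))
    simp [g]
  have h1 := hcont.tendsto 0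
  rw [h0] at h1
  have h2 := (EMetric.tendsto_nhds.1 h1) ε hε
  obtain ⟨r, hr, hr'⟩ := Metric.eventually_nhds_iff.1 h2
  refine ⟨r, hr, fun t ht => ?_⟩
  have h3 := (hr' (y := t) (by simpa using ht)).le
  rw [Lp.edist_def] at h3
  refine (eLpNorm_congr_ae ?_).trans_le h3
  have h4 := (hg t).quasiMeasurePreserving.ae_eq_comp hf.coeFn_toLp
  filter_upwards [Lp.coeFn_compMeasurePreserving (hf.toLp f) (hg t), hf.coeFn_toLp, h4]
    with x hx1 hx2 hx3
  simp only [Pi.sub_apply]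
  rw [hx1, hx2, hx3]
  rfl

/-- Jensen's inequality for the probability density `ρ`, obtained from Cauchy–Schwarz with the
splitting `ρ|h| = ρ^{1/2} · ρ^{1/2}|h|`. -/
theorem enorm_integral_smul_sq_le {ρ : E n → ℝ} (hρm : Measurable ρ) (hρ0 : ∀ t, 0 ≤ ρ t)
    (hρ1 : ∫⁻ t, ENNReal.ofReal (ρ t) = 1) {h : E n → ℂ} (hh : Measurable h) :
    ‖∫ t, ρ t • h t‖ₑ ^ 2 ≤ ∫⁻ t, ENNReal.ofReal (ρ t) * ‖h t‖ₑ ^ 2 := by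
  have hsq : ∀ y : ENNReal, (y ^ (1 / 2 : ℝ)) ^ 2 = y := fun y => by
    rw [← ENNReal.rpow_natCast, ← ENNReal.rpow_mul]
    norm_num
  have hmul : ∀ t, ENNReal.ofReal (ρ t) * ‖h t‖ₑ
      = ((fun t => ENNReal.ofReal (ρ t) ^ (1 / 2 : ℝ))
          * (fun t => ENNReal.ofReal (ρ t) ^ (1 / 2 : ℝ) * ‖h t‖ₑ)) t := fun t => by
    simp only [Pi.mul_apply]
    rw [← mul_assoc, ← sq, hsq]
  have h1 : ‖∫ t, ρ t • h t‖ₑ ≤ ∫⁻ t, ENNReal.ofReal (ρ t) * ‖h t‖ₑ := by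
    refine (enorm_integral_le_lintegral_enorm _).trans_eq (lintegral_congr fun t => ?_)
    rw [enorm_smul, Real.enorm_of_nonneg (hρ0 t)]
  have hm : Measurable fun t => ENNReal.ofReal (ρ t) ^ (1 / 2 : ℝ) :=
    (ENNReal.measurable_ofReal.comp hρm).pow_const _
  have h2 := ENNReal.lintegral_mul_le_Lp_mul_Lq volume Real.HolderConjugate.two_two
    hm.aemeasurable (g := fun t => ENNReal.ofReal (ρ t) ^ (1 / 2 : ℝ) * ‖h t‖ₑ)
    (hm.mul hh.enorm).aemeasurable
  rw [← lintegral_congr hmul] at h2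
  have hsq' : ∀ y : ENNReal, (y ^ (1 / 2 : ℝ)) ^ (2 : ℝ) = y := fun y => by
    rw [← ENNReal.rpow_mul]
    norm_num
  simp only [hsq', hρ1, ENNReal.one_rpow, one_mul, ENNReal.mul_rpow_of_nonneg _ _ zero_le_two] at h2
  calc ‖∫ t, ρ t • h t‖ₑ ^ 2 ≤ _ := pow_le_pow_left' (h1.trans h2) 2
    _ = _ := by
      rw [hsq]
      refine lintegral_congr fun t => ?_
      norm_cast

/-- Mollifiers with small support converge in `L²`. -/
theorem exists_eLpNorm_mollify_sub_le {f : E n → ℂ} (hf : MemLp f 2 volume) {ε : ENNReal}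
    (hε : 0 < ε) : ∃ r > 0, ∀ ρ : E n → ℝ, Continuous ρ → HasCompactSupport ρ → (∀ t, 0 ≤ ρ t) →
      ∫ t, ρ t = 1 → Function.support ρ ⊆ Metric.ball 0 r →
      eLpNorm (fun x => (∫ t, ρ t • f (x - t)) - f x) 2 volume ≤ ε := by
  -- Tonelli's theorem below needs joint measurability of `(x, t) ↦ f (x - t)`, hence a genuinely
  -- measurable representative.
  obtain ⟨f', hf'm, hff'⟩ := hf.1
  have hf' := hf.ae_eq hff'
  obtain ⟨r, hr, hr'⟩ := exists_eLpNorm_translate_sub_le hf' hε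
  refine ⟨r, hr, fun ρ hρc hρs hρ0 hρ1 hρr => ?_⟩
  have hae : (fun x => (∫ t, ρ t • f (x - t)) - f x)
      =ᵐ[volume] fun x => ∫ t, ρ t • (f' (x - t) - f' x) := by
    filter_upwards [hff'] with x hx
    have h1 : ∫ t, ρ t • f (x - t) = ∫ t, ρ t • f' (x - t) := by
      refine integral_congr_ae ?_
      have := (quasiMeasurePreserving_sub_left_of_right_invariant volume x).ae_eq_comp hff'
      filter_upwards [this] with t ht
      simp only [Function.comp_apply] at ht
      rw [ht]
    have hint : Integrable (fun t => ρ t • f' (x - t)) := by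
      have := (hρs.convolutionExists_left (ContinuousLinearMap.lsmul ℝ ℝ) hρc
        (hf'.locallyIntegrable one_le_two)) x
      exact this
    have hint2 : Integrable (fun t => ρ t • f' x) :=
      (hρc.integrable_of_hasCompactSupport hρs).smul_const _
    simp_rw [smul_sub]
    rw [integral_sub hint hint2, integral_smul_const, hρ1, one_smul, h1, hx]
  rw [eLpNorm_congr_ae hae]
  have hρ1' : ∫⁻ t, ENNReal.ofReal (ρ t) = 1 := by
    rw [← ofReal_integral_eq_lintegral_ofReal (hρc.integrable_of_hasCompactSupport hρs)
      (Eventually.of_forall hρ0), hρ1, ENNReal.ofReal_one]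
  have key : eLpNorm (fun x => ∫ t, ρ t • (f' (x - t) - f' x)) 2 volume ^ 2 ≤ ε ^ 2 := by
    have hsqn : ∀ u : E n → ℂ, eLpNorm u 2 volume ^ 2 = ∫⁻ x, ‖u x‖ₑ ^ 2 := fun u => by
      rw [eLpNorm_eq_lintegral_rpow_enorm_toReal (by simp) (by simp), ← ENNReal.rpow_natCast,
        ← ENNReal.rpow_mul]
      norm_num
    have hmeas : Measurable fun p : E n × E n => f' (p.1 - p.2) - f' p.1 :=
      (hf'm.measurable.comp (measurable_fst.sub measurable_snd)).sub
        (hf'm.measurable.comp measurable_fst)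
    rw [hsqn]
    calc ∫⁻ x, ‖∫ t, ρ t • (f' (x - t) - f' x)‖ₑ ^ 2
        ≤ ∫⁻ x, ∫⁻ t, ENNReal.ofReal (ρ t) * ‖f' (x - t) - f' x‖ₑ ^ 2 :=
          lintegral_mono fun x => enorm_integral_smul_sq_le hρc.measurable hρ0 hρ1'
            (hmeas.comp measurable_prodMk_left)
      _ = ∫⁻ t, ∫⁻ x, ENNReal.ofReal (ρ t) * ‖f' (x - t) - f' x‖ₑ ^ 2 := by
          refine lintegral_lintegral_swap (Measurable.aemeasurable ?_)
          exact (ENNReal.measurable_ofReal.comp (hρc.measurable.comp measurable_snd)).mul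
            (hmeas.enorm.pow_const 2)
      _ ≤ ∫⁻ t, ENNReal.ofReal (ρ t) * ε ^ 2 := by
          refine lintegral_mono fun t => ?_
          have hm : Measurable fun x => f' (x - t) - f' x := hmeas.comp measurable_prodMk_right
          rw [lintegral_const_mul _ (hm.enorm.pow_const 2)]
          by_cases ht : ρ t = 0
          · simp [ht]
          · refine mul_le_mul_right ?_ _
            rw [← hsqn]
            exact pow_le_pow_left' (hr' t (by simpa using hρr ht)) 2
      _ = ε ^ 2 := by
          have hm : Measurable fun t => ENNReal.ofReal (ρ t) :=
            ENNReal.measurable_ofReal.comp hρc.measurable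
          rw [lintegral_mul_const _ hm, hρ1', one_mul]
  exact (ENNReal.pow_le_pow_left_iff two_ne_zero).1 key

/-- Mollifying in an admissible direction commutes with weak differentiation inside `Ω`. -/
theorem fderiv_mollify {Ω : Set (E n)} (hΩ : MeasurableSet Ω) {i : Fin n} {f g : L2 Ω}
    (h : HasWeakPartial Ω i f g) {ρ : E n → ℝ} (hρ : ContDiff ℝ ∞ ρ) (hρs : HasCompactSupport ρ)
    {x : E n} (hx : ∀ t ∈ tsupport ρ, x - t ∈ Ω) :
    fderiv ℝ (fun x => ∫ t, ρ t • Ω.indicator f (x - t)) x (EuclideanSpace.single i 1)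
      = ∫ t, ρ t • Ω.indicator g (x - t) := by
  have hfm : MemLp (Ω.indicator f) 2 volume := (memLp_indicator_iff_restrict hΩ).2 (Lp.memLp f)
  have hfl := hfm.locallyIntegrable one_le_two
  have hd := hρs.hasFDerivAt_convolution_left (μ := volume) (ContinuousLinearMap.lsmul ℝ ℝ)
    (hρ.of_le (by simp)) hfl x
  have hd' : HasFDerivAt (fun x => ∫ t, ρ t • Ω.indicator f (x - t)) _ x := hd
  -- The reflected kernel `y ↦ ρ (x - y)` is an admissible test function in `Ω` by `hx`; its
  -- derivative carries the sign that cancels the one in the definition of the weak derivative.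
  have hψ : ContDiff ℝ ∞ (fun y => ρ (x - y)) := hρ.comp (contDiff_const.sub contDiff_id)
  have hψt : tsupport (fun y => ρ (x - y)) ⊆ (fun y => x - y) ⁻¹' tsupport ρ :=
    closure_minimal (fun y hy => subset_tsupport ρ hy)
      ((isClosed_tsupport ρ).preimage (by fun_prop))
  have hψs : HasCompactSupport (fun y => ρ (x - y)) := by
    refine (hρs.isCompact.image (f := fun t => x - t) (by fun_prop)).of_isClosed_subset
      (isClosed_tsupport _) fun y hy => ⟨x - y, hψt hy, by simp⟩
  have hψΩ : tsupport (fun y => ρ (x - y)) ⊆ Ω := fun y hy => by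
    have := hx _ (hψt hy)
    rwa [sub_sub_cancel] at this
  have hw := h _ hψ hψs hψΩ
  have hψd : ∀ y, fderiv ℝ (fun y => ρ (x - y)) y = - fderiv ℝ ρ (x - y) := fun y => by
    have h1 : HasFDerivAt (fun y => x - y) (-ContinuousLinearMap.id ℝ (E n)) y := by
      simpa using (hasFDerivAt_id (𝕜 := ℝ) y).const_sub x
    have h2 := (hρ.differentiable (by simp) (x - y)).hasFDerivAt.comp y h1
    rw [show (fun y => ρ (x - y)) = ρ ∘ (fun y => x - y) from rfl, h2.fderiv]
    ext
    simp
  rw [hd'.fderiv]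
  have hex : ConvolutionExistsAt (fderiv ℝ ρ) (Ω.indicator f) x
      ((ContinuousLinearMap.lsmul ℝ ℝ).precompL (E n)) volume :=
    (hρs.fderiv ℝ).convolutionExists_left _ (hρ.continuous_fderiv (by simp)) hfl x
  rw [convolution, ContinuousLinearMap.integral_apply hex]
  simp only [ContinuousLinearMap.precompL_apply, ContinuousLinearMap.lsmul_apply]
  have hswap : ∀ (k : E n → ℝ) (u : L2 Ω), ∫ t, k t • Ω.indicator u (x - t)
      = ∫ y in Ω, k (x - y) • u y := fun k u => by
    rw [← integral_sub_left_eq_self (fun t => k t • Ω.indicator u (x - t)) volume x,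
      ← integral_indicator hΩ]
    refine integral_congr_ae (Eventually.of_forall fun y => ?_)
    by_cases hy : y ∈ Ω <;> simp [hy]
  rw [hswap (fun t => fderiv ℝ ρ t (EuclideanSpace.single i 1)), hswap ρ]
  simp only [hψd, neg_apply, neg_smul, integral_neg, neg_inj] at hw
  exact hw

/-- If balls around translates of points of `Ω` in a fixed direction stay in `Ω`, then functions
with weak derivatives in `L²(Ω)` are approximated by smooth functions on the whole space. -/
theorem exists_contDiff_approx {Ω : Set (E n)} (hΩ : MeasurableSet Ω) {a : E n}
    (ha : ∀ δ, 0 < δ → ∀ x ∈ Ω, Metric.closedBall (x + δ • a) δ ⊆ Ω) {f : L2 Ω} {g : Fin n → L2 Ω}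
    (h : ∀ i, HasWeakPartial Ω i f (g i)) {ε : ENNReal} (hε : 0 < ε) :
    ∃ F : E n → ℂ, ContDiff ℝ ∞ F ∧
      eLpNorm (fun x => F x - f x) 2 (volume.restrict Ω) ≤ ε ∧
      ∀ i, eLpNorm (fun x => fderiv ℝ F x (EuclideanSpace.single i 1) - g i x) 2
        (volume.restrict Ω) ≤ ε := by
  have hind : ∀ u : L2 Ω, MemLp (Ω.indicator u) 2 volume := fun u =>
    (memLp_indicator_iff_restrict hΩ).2 (Lp.memLp u)
  have key : ∀ u : L2 Ω, ∃ r > 0, ∀ ρ : E n → ℝ, Continuous ρ → HasCompactSupport ρ →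
      (∀ t, 0 ≤ ρ t) → ∫ t, ρ t = 1 → Function.support ρ ⊆ Metric.ball 0 r →
      eLpNorm (fun x => (∫ t, ρ t • Ω.indicator u (x - t)) - u x) 2 (volume.restrict Ω) ≤ ε := by
    intro u
    obtain ⟨r, hr, hr'⟩ := exists_eLpNorm_mollify_sub_le (hind u) hε
    refine ⟨r, hr, fun ρ h1 h2 h3 h4 h5 => ?_⟩
    refine le_trans (le_of_eq (eLpNorm_congr_ae ?_)) ((eLpNorm_mono_measure _
      Measure.restrict_le_self).trans (hr' ρ h1 h2 h3 h4 h5))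
    filter_upwards [ae_restrict_mem hΩ] with x hx
    simp [hx]
  obtain ⟨r0, hr0, H0⟩ := key f
  choose r hr H using fun i => key (g i)
  obtain ⟨r', hr', hr'le⟩ : ∃ r' > 0, r' ≤ r0 ∧ ∀ i, r' ≤ r i := by
    rcases isEmpty_or_nonempty (Fin n) with hn | hn
    · exact ⟨r0, hr0, le_rfl, fun i => hn.elim i⟩
    · obtain ⟨i0, hi0⟩ := Finite.exists_min r
      exact ⟨min r0 (r i0), lt_min hr0 (hr i0), min_le_left _ _,
        fun i => (min_le_right _ _).trans (hi0 i)⟩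
  -- The kernel is centred at `-δa` with radius `δ`, so that `x - t` runs through the ball about `x
  -- + δa` that stays in `Ω`. Since `δ(‖a‖ + 1) < r'`, its support is still in the ball of radius
  -- `r'` about the origin.
  set δ := r' / (‖a‖ + 2) with hδdef
  have hδ : 0 < δ := by positivity
  let b : ContDiffBump (-(δ • a)) := ⟨δ / 2, δ, by positivity, by linarith⟩
  have hts : tsupport (b.normed volume) = Metric.closedBall (-(δ • a)) δ :=
    b.tsupport_normed_eq
  have hρs : HasCompactSupport (b.normed (volume : Measure (E n))) := b.hasCompactSupport_normed
  have hρc : ContDiff ℝ ∞ (b.normed (volume : Measure (E n))) := b.contDiff_normed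
  have hsupp : ∀ s, r' ≤ s →
      Function.support (b.normed (volume : Measure (E n))) ⊆ Metric.ball 0 s := by
    intro s hs
    rw [b.support_normed_eq]
    intro t ht
    rw [Metric.mem_ball, dist_eq_norm, sub_neg_eq_add] at ht
    rw [mem_ball_zero_iff]
    have h1 : ‖t‖ ≤ ‖t + δ • a‖ + ‖δ • a‖ := by
      simpa using norm_sub_le (t + δ • a) (δ • a)
    rw [norm_smul, Real.norm_of_nonneg hδ.le] at h1
    have h2 : δ * (‖a‖ + 2) = r' := by rw [hδdef]; field_simp
    have h3 : ‖t + δ • a‖ < δ := ht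
    nlinarith
  refine ⟨fun x => ∫ t, b.normed volume t • Ω.indicator f (x - t), ?_, ?_, fun i => ?_⟩
  · exact hρs.contDiff_convolution_left (μ := volume) (ContinuousLinearMap.lsmul ℝ ℝ) hρc
      ((hind f).locallyIntegrable one_le_two)
  · exact H0 _ hρc.continuous hρs b.nonneg_normed b.integral_normed (hsupp _ hr'le.1)
  · refine le_trans (le_of_eq (eLpNorm_congr_ae ?_))
      (H i _ hρc.continuous hρs b.nonneg_normed b.integral_normed (hsupp _ (hr'le.2 i)))
    filter_upwards [ae_restrict_mem hΩ] with x hx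
    rw [fderiv_mollify hΩ (h i) hρc hρs]
    intro t ht
    refine ha δ hδ x hx ?_
    rw [hts, Metric.mem_closedBall, dist_eq_norm] at ht
    rw [Metric.mem_closedBall, dist_eq_norm]
    rwa [show x - t - (x + δ • a) = -(t - -(δ • a)) by abel, norm_neg]

end Mollify

/-! ### Slicing `ℝ³` along the vertical direction -/

/-- The half line on the side of `0` opposite to `ν`. -/
abbrev halfLine (ν : ℝ) : Set ℝ := {t | ν * t < 0}

/-- The half space with outer unit normal `ν e₃`, for `ν = ±1`. -/
abbrev halfSpace (ν : ℝ) : Set (E 3) := {x | ν * x 2 < 0}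

theorem upper_eq_halfSpace : upper = halfSpace (-1) := by
  ext x; simp

theorem lower_eq_halfSpace : lower = halfSpace 1 := by
  ext x; simp

theorem isOpen_halfSpace (ν : ℝ) : IsOpen (halfSpace ν) :=
  isOpen_lt (by fun_prop) continuous_const

theorem measurableSet_halfSpace (ν : ℝ) : MeasurableSet (halfSpace ν) :=
  (isOpen_halfSpace ν).measurableSet

/-- The identification of `ℝ² × ℝ` with `ℝ³`. -/
def joinVert : E 2 × ℝ ≃ᵐ E 3 :=
  ((MeasurableEquiv.prodComm.trans
    ((MeasurableEquiv.refl ℝ).prodCongr (MeasurableEquiv.toLp 2 (Fin 2 → ℝ)).symm)).trans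
    (MeasurableEquiv.piFinSuccAbove (fun _ => ℝ) (2 : Fin 3)).symm).trans
    (MeasurableEquiv.toLp 2 (Fin 3 → ℝ))

theorem joinVert_apply (p : E 2 × ℝ) : joinVert p = !₂[p.1 0, p.1 1, p.2] := by
  ext i
  fin_cases i <;> simp [joinVert] <;> rfl

@[simp] theorem joinVert_apply_two (p : E 2 × ℝ) : joinVert p 2 = p.2 := by
  simp [joinVert_apply]

@[simp] theorem horiz_joinVert (p : E 2 × ℝ) : horiz (joinVert p) = p.1 := by
  ext i
  fin_cases i <;> simp [joinVert_apply, horiz]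

theorem joinVert_zero (y : E 2) : joinVert (y, 0) = onInterface y := by
  simp [joinVert_apply, onInterface]

theorem measurePreserving_joinVert :
    MeasurePreserving joinVert ((volume : Measure (E 2)).prod volume) volume := by
  have h1 : MeasurePreserving
      (Prod.map id WithLp.ofLp : ℝ × E 2 → ℝ × (Fin 2 → ℝ)) (volume.prod volume)
      (volume.prod volume) :=
    (MeasurePreserving.id volume).prod (PiLp.volume_preserving_ofLp (Fin 2))
  have h2 := (volume_preserving_piFinSuccAbove (fun _ => ℝ) (2 : Fin 3)).symm
  exact (PiLp.volume_preserving_toLp (Fin 3)).comp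
    (h2.comp (h1.comp Measure.measurePreserving_swap))

theorem joinVert_preimage_halfSpace (ν : ℝ) :
    joinVert ⁻¹' halfSpace ν = univ ×ˢ halfLine ν := by
  ext p; simp

theorem measurePreserving_joinVert_halfSpace (ν : ℝ) :
    MeasurePreserving joinVert ((volume : Measure (E 2)).prod (volume.restrict (halfLine ν)))
      (volume.restrict (halfSpace ν)) := by
  have := measurePreserving_joinVert.restrict_preimage (measurableSet_halfSpace ν)
  rwa [joinVert_preimage_halfSpace, ← Measure.prod_restrict, Measure.restrict_univ] at this

theorem continuous_onInterface : Continuous onInterface := by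
  unfold onInterface; fun_prop

/-- Null sets of the plane pull back to null sets, so almost-everywhere identities on the interface
lift to the half space. -/
theorem quasiMeasurePreserving_horiz (ν : ℝ) :
    Measure.QuasiMeasurePreserving horiz (volume.restrict (halfSpace ν))
      (volume.restrict plane) := by
  rw [Measure.restrict_univ]
  have h := (Measure.quasiMeasurePreserving_fst (μ := (volume : Measure (E 2)))
    (ν := volume.restrict (halfLine ν))).comp
    ((measurePreserving_joinVert_halfSpace ν).symm joinVert).quasiMeasurePreserving
  have heq : horiz = Prod.fst ∘ joinVert.symm := by
    funext x
    conv_lhs => rw [← joinVert.apply_symm_apply x, horiz_joinVert]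
    rfl
  rw [heq]
  exact h

/-! ### Integration by parts for test functions -/

/-- The indicator of `Ω` is constant on lines in direction `i`, so `1_Ω G` is differentiable along
them and can be integrated by parts against the constant `1`. -/
theorem setIntegral_fderiv_eq_zero {n : ℕ} {Ω : Set (E n)} (hΩ : MeasurableSet Ω) {i : Fin n}
    (hi : ∀ x : E n, ∀ t : ℝ, x + t • EuclideanSpace.single i 1 ∈ Ω ↔ x ∈ Ω) {G : E n → ℝ}
    (hG : ContDiff ℝ 1 G) (hGs : HasCompactSupport G) :
    ∫ x in Ω, fderiv ℝ G x (EuclideanSpace.single i 1) = 0 := by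
  set e : E n := EuclideanSpace.single i 1
  have hint : Integrable (fun x => fderiv ℝ G x e) :=
    ((hG.continuous_fderiv (by simp)).clm_apply continuous_const).integrable_of_hasCompactSupport
      (hGs.fderiv_apply ℝ e)
  have h := integral_bilinear_hasLineDerivAt_right_eq_neg_left_of_integrable
    (μ := (volume : Measure (E n))) (f := fun _ => (1 : ℝ)) (f' := fun _ => 0) (v := e)
    (g := Ω.indicator G) (g' := Ω.indicator (fun x => fderiv ℝ G x e))
    (B := ContinuousLinearMap.lsmul ℝ ℝ) (by simp)
    (by simpa using hint.indicator hΩ)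
    (by simpa using (hG.continuous.integrable_of_hasCompactSupport hGs).indicator hΩ)
    (fun x _ => (hasFDerivAt_const (1 : ℝ) x).hasLineDerivAt e)
    (fun x _ => by
      have h1 := (hG.differentiable (by simp) x).hasFDerivAt.hasLineDerivAt e
      rw [HasLineDerivAt] at h1 ⊢
      by_cases hx : x ∈ Ω
      · rw [indicator_of_mem hx]
        refine h1.congr_of_eventuallyEq (Eventually.of_forall fun t => ?_)
        exact indicator_of_mem ((hi x t).2 hx) _
      · rw [indicator_of_notMem hx]
        refine (hasDerivAt_const (0 : ℝ) (0 : ℝ)).congr_of_eventuallyEq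
          (Eventually.of_forall fun t => ?_)
        exact indicator_of_notMem (fun h => hx ((hi x t).1 h)) _)
  simpa [integral_indicator hΩ] using h

theorem setIntegral_deriv_halfLine {ν : ℝ} (hν : ν = 1 ∨ ν = -1) {f : ℝ → ℝ}
    (hf : ContDiff ℝ 1 f) (hfs : HasCompactSupport f) :
    ∫ t in halfLine ν, deriv f t = ν * f 0 := by
  rcases hν with rfl | rfl
  · have : halfLine 1 = Iio 0 := by ext; simp
    rw [this, ← integral_Iic_eq_integral_Iio, hfs.integral_Iic_deriv_eq hf]
    simp
  · have : halfLine (-1) = Ioi 0 := by ext; simp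
    rw [this, hfs.integral_Ioi_deriv_eq hf]
    simp

theorem hasDerivAt_joinVert (y : E 2) (t : ℝ) :
    HasDerivAt (fun t => joinVert (y, t)) (EuclideanSpace.single 2 1) t := by
  have h : (fun t => joinVert (y, t))
      = fun t : ℝ => onInterface y + t • (EuclideanSpace.single 2 1 : E 3) := by
    ext t i
    fin_cases i <;> simp [joinVert_apply, onInterface]
  rw [h]
  simpa using ((hasDerivAt_id t).smul_const (EuclideanSpace.single 2 1 : E 3)).const_add
    (onInterface y)

/-- Fubini in the coordinates `joinVert` reduces this to the fundamental theorem of calculus on each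
vertical half line. -/
theorem setIntegral_fderiv_vert {ν : ℝ} (hν : ν = 1 ∨ ν = -1) {G : E 3 → ℝ}
    (hG : ContDiff ℝ 1 G) (hGs : HasCompactSupport G) :
    ∫ x in halfSpace ν, fderiv ℝ G x (EuclideanSpace.single 2 1)
      = ν * ∫ y in plane, G (onInterface y) := by
  set e : E 3 := EuclideanSpace.single 2 1
  have hint : Integrable (fun x => fderiv ℝ G x e) :=
    ((hG.continuous_fderiv (by simp)).clm_apply continuous_const).integrable_of_hasCompactSupport
      (hGs.fderiv_apply ℝ e)
  have hmp := measurePreserving_joinVert_halfSpace ν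
  have hint' := (hmp.integrable_comp_emb joinVert.measurableEmbedding).2
    (hint.integrableOn (s := halfSpace ν))
  rw [← hmp.integral_comp joinVert.measurableEmbedding, integral_prod (fun z => fderiv ℝ G (joinVert z) e) hint',
    Measure.restrict_univ, ← integral_const_mul]
  refine integral_congr_ae (Eventually.of_forall fun y => ?_)
  have haff : (fun t => joinVert (y, t)) = fun t : ℝ => onInterface y + t • e := by
    ext t i
    fin_cases i <;> simp [joinVert_apply, onInterface, e]
  have hc : ContDiff ℝ 1 fun t => G (joinVert (y, t)) := by
    refine hG.comp ?_
    rw [haff]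
    fun_prop
  have hcs : HasCompactSupport fun t => G (joinVert (y, t)) := by
    refine HasCompactSupport.intro (hGs.isCompact.image (f := fun x : E 3 => x 2) (by fun_prop))
      fun t ht => ?_
    by_contra h
    exact ht ⟨joinVert (y, t), subset_tsupport _ h, by simp⟩
  have := setIntegral_deriv_halfLine hν hc hcs
  rw [joinVert_zero] at this
  refine Eq.trans (integral_congr_ae (Eventually.of_forall fun t => ?_)) this
  exact (((hG.differentiable (by simp) _).hasFDerivAt.comp_hasDerivAt t
    (hasDerivAt_joinVert y t)).deriv).symm

/-! ### Graphs of test functions and their closures -/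

section BoundedMultiplier

variable {X : Type*} [MeasurableSpace X] {μ : Measure X}

theorem memLp_smul_of_bound {c : X → ℝ} {C : ℝ} (hc : AEStronglyMeasurable c μ)
    (hC : ∀ x, |c x| ≤ C) (u : Lp ℂ 2 μ) : MemLp (fun x => c x • u x) 2 μ := by
  refine (Lp.memLp u).of_le_mul (c := C) (hc.smul (Lp.aestronglyMeasurable u))
    (Eventually.of_forall fun x => ?_)
  rw [norm_smul]
  exact mul_le_mul_of_nonneg_right (hC x) (norm_nonneg _)

/-- Dominated convergence with majorant `(C + |c₀|)‖u‖`. It is used with `c₀ = 1` for cutoffs and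
`c₀ = 0` for their derivatives. -/
theorem tendsto_toLp_smul {c : ℕ → X → ℝ} {C c₀ : ℝ} (hc : ∀ k, AEStronglyMeasurable (c k) μ)
    (hC : ∀ k x, |c k x| ≤ C) (hlim : ∀ x, Tendsto (fun k => c k x) atTop (𝓝 c₀))
    (u : Lp ℂ 2 μ) :
    Tendsto (fun k => (memLp_smul_of_bound (hc k) (hC k) u).toLp) atTop (𝓝 (c₀ • u)) := by
  have hu : MemLp (fun x => c₀ • u x) 2 μ := (Lp.memLp u).const_smul c₀
  have hcu : c₀ • u = hu.toLp := by
    refine Lp.ext ((Lp.coeFn_smul c₀ u).trans ?_)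
    exact hu.coeFn_toLp.symm
  rw [hcu, Lp.tendsto_Lp_iff_tendsto_eLpNorm'']
  have h1 : Tendsto (fun k => ∫⁻ x, ‖c k x • u x - c₀ • u x‖ₑ ^ (2 : ℝ) ∂μ) atTop
      (𝓝 (∫⁻ _, 0 ∂μ)) := by
    refine tendsto_lintegral_of_dominated_convergence'
      (fun x => ((ENNReal.ofReal (C + |c₀|)) * ‖u x‖ₑ) ^ (2 : ℝ)) (fun k => ?_) (fun k => ?_) ?_ ?_
    · exact ((((hc k).smul (Lp.aestronglyMeasurable u)).sub
        ((Lp.aestronglyMeasurable u).const_smul c₀)).enorm).pow_const _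
    · refine Eventually.of_forall fun x => ?_
      beta_reduce
      rw [← sub_smul, enorm_smul]
      refine ENNReal.rpow_le_rpow (mul_le_mul_left ?_ _) (by norm_num)
      rw [← ofReal_norm]
      refine ENNReal.ofReal_le_ofReal ?_
      rw [Real.norm_eq_abs]
      exact (abs_sub _ _).trans (add_le_add_left (hC k x) _)
    · simp_rw [ENNReal.mul_rpow_of_nonneg _ _ (zero_le_two : (0 : ℝ) ≤ 2)]
      rw [lintegral_const_mul' _ _ (by finiteness)]
      refine ENNReal.mul_ne_top (by finiteness) ?_
      have := (Lp.memLp u).2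
      have h := (eLpNorm_lt_top_iff_lintegral_rpow_enorm_lt_top (by simp) (by simp)).1 this
      simpa using h.ne
    · refine Eventually.of_forall fun x => ?_
      have h2 : Tendsto (fun k => c k x • u x - c₀ • u x) atTop (𝓝 (c₀ • u x - c₀ • u x)) :=
        ((hlim x).smul_const _).sub_const _
      rw [sub_self] at h2
      have h3 := h2.enorm
      rw [enorm_zero] at h3
      have h4 := (ENNReal.continuous_rpow_const (y := 2)).continuousAt.tendsto.comp h3
      simpa [Function.comp_def] using h4
  rw [lintegral_zero] at h1
  have h2 := (ENNReal.continuous_rpow_const (y := 1 / 2)).continuousAt.tendsto.comp h1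
  simp only [Function.comp_def] at h2
  rw [ENNReal.zero_rpow_of_pos (by norm_num)] at h2
  refine h2.congr fun k => ?_
  rw [eLpNorm_eq_lintegral_rpow_enorm_toReal (by simp) (by simp)]
  simp

end BoundedMultiplier

section Graph

variable {n m : ℕ}

/-- The set of `(φ, ∇φ, φ ∘ ι)` for test functions `φ ∈ C_c^∞(ℝⁿ)`, where `φ` and `∇φ` are
restricted to `Ω` and `φ ∘ ι` is restricted to `S`. -/
def testGraph (Ω : Set (E n)) (ι : E m → E n) (S : Set (E m)) :
    Submodule ℝ (L2 Ω × (Fin n → L2 Ω) × L2 S) where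
  carrier := {p | ∃ φ : E n → ℂ, ContDiff ℝ ∞ φ ∧ HasCompactSupport φ ∧
    p.1 =ᵐ[volume.restrict Ω] φ ∧
    (∀ i, p.2.1 i =ᵐ[volume.restrict Ω] fun x => fderiv ℝ φ x (EuclideanSpace.single i 1)) ∧
    p.2.2 =ᵐ[volume.restrict S] fun y => φ (ι y)}
  add_mem' := by
    rintro p q ⟨φ, h1, h2, h3, h4, h5⟩ ⟨ψ, k1, k2, k3, k4, k5⟩
    refine ⟨φ + ψ, h1.add k1, h2.add k2, ?_, fun i => ?_, ?_⟩
    · exact (Lp.coeFn_add _ _).trans (h3.add k3)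
    · refine (Lp.coeFn_add _ _).trans (((h4 i).add (k4 i)).trans (Eventually.of_forall fun x => ?_))
      simp only [Pi.add_apply]
      rw [fderiv_add (h1.differentiable (by simp) x) (k1.differentiable (by simp) x)]
      rfl
    · exact (Lp.coeFn_add _ _).trans (h5.add k5)
  zero_mem' := by
    refine ⟨0, contDiff_const, HasCompactSupport.zero, Lp.coeFn_zero _ _ _, fun i => ?_,
      Lp.coeFn_zero _ _ _⟩
    refine (Lp.coeFn_zero _ _ _).trans (Eventually.of_forall fun x => ?_)
    simp
  smul_mem' := by
    rintro c p ⟨φ, h1, h2, h3, h4, h5⟩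
    refine ⟨c • φ, h1.const_smul c, h2.smul_left (f := fun _ => c), ?_, fun i => ?_, ?_⟩
    · exact (Lp.coeFn_smul _ _).trans (h3.const_smul c)
    · refine (Lp.coeFn_smul _ _).trans (((h4 i).const_smul c).trans
        (Eventually.of_forall fun x => ?_))
      simp only [Pi.smul_apply]
      rw [fderiv_const_smul (h1.differentiable (by simp) x)]
      rfl
    · exact (Lp.coeFn_smul _ _).trans (h5.const_smul c)

/-- The Sobolev graph: triples `(f, ∇f, trace)` that are limits of test functions. -/
abbrev sobolevGraph (Ω : Set (E n)) (ι : E m → E n) (S : Set (E m)) :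
    Submodule ℝ (L2 Ω × (Fin n → L2 Ω) × L2 S) :=
  (testGraph Ω ι S).topologicalClosure

theorem mem_sobolevGraph_of_tendsto {Ω : Set (E n)} {ι : E m → E n} {S : Set (E m)} {f : L2 Ω}
    {g : Fin n → L2 Ω} {h : L2 S} {F : ℕ → L2 Ω} {G : ℕ → Fin n → L2 Ω} {K : ℕ → L2 S}
    (hF : Tendsto F atTop (𝓝 f)) (hG : ∀ i, Tendsto (fun k => G k i) atTop (𝓝 (g i)))
    (hK : Tendsto K atTop (𝓝 h)) (hmem : ∀ k, (F k, G k, K k) ∈ testGraph Ω ι S) :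
    (f, g, h) ∈ sobolevGraph Ω ι S :=
  mem_closure_of_tendsto (hF.prodMk_nhds ((tendsto_pi_nhds.2 hG).prodMk_nhds hK))
    (Eventually.of_forall hmem)

/-- A sequence of smooth cutoff functions exhausting `ℝⁿ`. -/
def cutoff (n k : ℕ) (x : E n) : ℝ :=
  (⟨1, 2, one_pos, one_lt_two⟩ : ContDiffBump (0 : E n)) ((1 / ((k : ℝ) + 1)) • x)

theorem contDiff_cutoff (n k : ℕ) : ContDiff ℝ ∞ (cutoff n k) :=
  ContDiffBump.contDiff _ |>.comp (contDiff_const_smul _)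

theorem hasCompactSupport_cutoff (n k : ℕ) : HasCompactSupport (cutoff n k) :=
  (ContDiffBump.hasCompactSupport _).comp_smul (by positivity)

theorem abs_cutoff_le (n k : ℕ) (x : E n) : |cutoff n k x| ≤ 1 := by
  rw [cutoff, abs_of_nonneg (ContDiffBump.nonneg _)]
  exact ContDiffBump.le_one _

theorem tendsto_inv_succ_smul (x : E n) :
    Tendsto (fun k : ℕ => (1 / ((k : ℝ) + 1)) • x) atTop (𝓝 0) := by
  simpa using (tendsto_one_div_add_atTop_nhds_zero_nat (𝕜 := ℝ)).smul_const x

theorem tendsto_cutoff (x : E n) : Tendsto (fun k => cutoff n k x) atTop (𝓝 1) := by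
  have h := (ContDiffBump.continuous
    (⟨1, 2, one_pos, one_lt_two⟩ : ContDiffBump (0 : E n))).continuousAt.tendsto.comp
    (tendsto_inv_succ_smul x)
  rwa [ContDiffBump.one_of_mem_closedBall _ (by simp)] at h

theorem fderiv_cutoff (k : ℕ) (x v : E n) : fderiv ℝ (cutoff n k) x v
    = (1 / ((k : ℝ) + 1)) * fderiv ℝ (⟨1, 2, one_pos, one_lt_two⟩ : ContDiffBump (0 : E n))
        ((1 / ((k : ℝ) + 1)) • x) v := by
  have h1 : HasFDerivAt (fun x : E n => (1 / ((k : ℝ) + 1)) • x)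
    ((1 / ((k : ℝ) + 1)) • ContinuousLinearMap.id ℝ (E n)) x :=
    ((1 / ((k : ℝ) + 1)) • ContinuousLinearMap.id ℝ (E n)).hasFDerivAt
  have h2 := ((ContDiffBump.contDiff (n := 1)
    (⟨1, 2, one_pos, one_lt_two⟩ : ContDiffBump (0 : E n))).differentiable
    (by simp) ((1 / ((k : ℝ) + 1)) • x)).hasFDerivAt.comp x h1
  rw [show cutoff n k = (⟨1, 2, one_pos, one_lt_two⟩ : ContDiffBump (0 : E n)) ∘
    (fun x : E n => (1 / ((k : ℝ) + 1)) • x) from rfl, h2.fderiv]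
  simp

theorem exists_fderiv_cutoff_bound (v : E n) : ∃ C, ∀ k x,
    |fderiv ℝ (cutoff n k) x v| ≤ (1 / ((k : ℝ) + 1)) * C := by
  have hc : Continuous fun x => fderiv ℝ (⟨1, 2, one_pos, one_lt_two⟩ : ContDiffBump (0 : E n))
      x v :=
    ((ContDiffBump.contDiff (n := 1) _).continuous_fderiv (by simp)).clm_apply continuous_const
  obtain ⟨C, hC⟩ := hc.bounded_above_of_compact_support
    ((ContDiffBump.hasCompactSupport _).fderiv_apply ℝ v)
  refine ⟨C, fun k x => ?_⟩
  rw [fderiv_cutoff, abs_mul, abs_of_nonneg (by positivity)]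
  exact mul_le_mul_of_nonneg_left (hC _) (by positivity)

/-- Smooth functions with the right integrability belong to the Sobolev graph. -/
theorem mem_sobolevGraph_of_contDiff {Ω : Set (E n)} {ι : E m → E n} (hι : Continuous ι)
    {S : Set (E m)} {F : E n → ℂ} (hF : ContDiff ℝ ∞ F) {f : L2 Ω} {g : Fin n → L2 Ω} {h : L2 S}
    (hf : f =ᵐ[volume.restrict Ω] F)
    (hg : ∀ i, g i =ᵐ[volume.restrict Ω] fun x => fderiv ℝ F x (EuclideanSpace.single i 1))
    (hh : h =ᵐ[volume.restrict S] fun y => F (ι y)) :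
    (f, g, h) ∈ sobolevGraph Ω ι S := by
  choose C hC using fun i : Fin n => exists_fderiv_cutoff_bound (EuclideanSpace.single i (1 : ℝ))
  have hC0 : ∀ i, 0 ≤ C i := fun i => by
    have := (abs_nonneg _).trans (hC i 0 0)
    simpa using this
  have hCle : ∀ i k x, |fderiv ℝ (cutoff n k) x (EuclideanSpace.single i 1)| ≤ C i :=
    fun i k x => (hC i k x).trans (mul_le_of_le_one_left (hC0 i) (by
      rw [div_le_one (by positivity)]
      linarith [(Nat.cast_nonneg k : (0 : ℝ) ≤ k)]))
  have hm : ∀ k (ν : Measure (E n)), AEStronglyMeasurable (cutoff n k) ν := fun k ν =>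
    (contDiff_cutoff n k).continuous.aestronglyMeasurable
  have hmι : ∀ k (ν : Measure (E m)), AEStronglyMeasurable (fun y => cutoff n k (ι y)) ν :=
    fun k ν => ((contDiff_cutoff n k).continuous.comp hι).aestronglyMeasurable
  have hmd : ∀ i k (ν : Measure (E n)), AEStronglyMeasurable
      (fun x => fderiv ℝ (cutoff n k) x (EuclideanSpace.single i 1)) ν := fun i k ν =>
    (((contDiff_cutoff n k).continuous_fderiv (by simp)).clm_apply
      continuous_const).aestronglyMeasurable
  have lim1 := tendsto_toLp_smul (fun k => hm k (volume.restrict Ω)) (abs_cutoff_le n)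
    tendsto_cutoff f
  have lim2 := fun i => tendsto_toLp_smul (fun k => hm k (volume.restrict Ω)) (abs_cutoff_le n)
    tendsto_cutoff (g i)
  -- This is the product-rule term in which the derivative falls on the cutoff; it decays like
  -- `1/(k+1)`.
  have lim3 := fun i => tendsto_toLp_smul (c₀ := 0) (fun k => hmd i k (volume.restrict Ω))
    (hCle i) (fun x => squeeze_zero_norm (fun k => hC i k x) (by
      simpa using (tendsto_one_div_add_atTop_nhds_zero_nat (𝕜 := ℝ)).mul_const (C i))) f
  have lim4 := tendsto_toLp_smul (fun k => hmι k (volume.restrict S))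
    (fun k y => abs_cutoff_le n k (ι y)) (fun y => tendsto_cutoff (ι y)) h
  rw [one_smul] at lim1 lim4
  have lim5 := fun i => (lim2 i).add (lim3 i)
  simp only [one_smul, zero_smul, add_zero] at lim5
  refine mem_sobolevGraph_of_tendsto lim1
    (G := fun k i => _) lim5 lim4 fun k => ?_
  refine ⟨fun x => cutoff n k x • F x, (contDiff_cutoff n k).smul hF,
    (hasCompactSupport_cutoff n k).smul_right, ?_, fun i => ?_, ?_⟩
  · refine (memLp_smul_of_bound (hm k _) (abs_cutoff_le n k) f).coeFn_toLp.trans ?_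
    filter_upwards [hf] with x hx
    rw [hx]
  · refine (Lp.coeFn_add _ _).trans 
      (((memLp_smul_of_bound (hm k _) (abs_cutoff_le n k) (g i)).coeFn_toLp.add
        (memLp_smul_of_bound (hmd i k _) (hCle i k) f).coeFn_toLp).trans ?_)
    filter_upwards [hf, hg i] with x hx1 hx2
    simp only [Pi.add_apply, hx1, hx2]
    rw [fderiv_fun_smul ((contDiff_cutoff n k).differentiable (by simp) x)
      (hF.differentiable (by simp) x)]
    simp
  · refine (memLp_smul_of_bound (hmι k _) (fun y => abs_cutoff_le n k (ι y)) h).coeFn_toLp.trans ?_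
    filter_upwards [hh] with x hx
    rw [hx]

/-- Functions with weak derivatives in `L²(Ω)` belong to the Sobolev graph (without trace). -/
theorem mem_sobolevGraph_of_hasWeakPartial {Ω : Set (E n)} (hΩ : MeasurableSet Ω) {a : E n}
    (ha : ∀ δ, 0 < δ → ∀ x ∈ Ω, Metric.closedBall (x + δ • a) δ ⊆ Ω) {ι : E m → E n}
    (hι : Continuous ι) {f : L2 Ω} {g : Fin n → L2 Ω} (h : ∀ i, HasWeakPartial Ω i f (g i)) :
    (f, g, (0 : L2 (∅ : Set (E m)))) ∈ sobolevGraph Ω ι ∅ := by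
  have hcl : IsClosed (sobolevGraph Ω ι (∅ : Set (E m)) :
      Set (L2 Ω × (Fin n → L2 Ω) × L2 (∅ : Set (E m)))) :=
    Submodule.isClosed_topologicalClosure _
  rw [← SetLike.mem_coe, ← hcl.closure_eq, EMetric.mem_closure_iff]
  intro ε hε
  obtain ⟨ε', hε', hε'ε⟩ := exists_between hε
  -- The bound by `1` keeps the errors finite, which puts the smooth approximant and its derivatives
  -- in `L²`.
  have hmin : 0 < min ε' 1 := lt_min hε' one_pos
  obtain ⟨F, hF, h1, h2⟩ := exists_contDiff_approx hΩ ha h hmin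
  have hmem : ∀ {u : E n → ℂ} {w : L2 Ω}, Continuous u →
      eLpNorm (fun x => u x - w x) 2 (volume.restrict Ω) ≤ min ε' 1 →
      MemLp u 2 (volume.restrict Ω) := by
    intro u w hu huw
    have h3 : MemLp (fun x => u x - w x) 2 (volume.restrict Ω) :=
      ⟨hu.aestronglyMeasurable.sub (Lp.aestronglyMeasurable w),
        huw.trans_lt ((min_le_right _ _).trans_lt ENNReal.one_lt_top)⟩
    have h4 := h3.add (Lp.memLp w)
    refine h4.congr_norm hu.aestronglyMeasurable (Eventually.of_forall fun x => ?_)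
    simp
  have hF0 := hmem hF.continuous h1
  have hFi := fun i => hmem ((hF.continuous_fderiv (by simp)).clm_apply continuous_const) (h2 i)
  refine ⟨(hF0.toLp, fun i => (hFi i).toLp, 0), mem_sobolevGraph_of_contDiff hι hF hF0.coeFn_toLp
    (fun i => (hFi i).coeFn_toLp) ((ae_restrict_iff' MeasurableSet.empty).2
      (Eventually.of_forall fun _ h => h.elim)),
    lt_of_le_of_lt ?_ hε'ε⟩
  have hdist : ∀ {u : E n → ℂ} {w : L2 Ω} (hu : MemLp u 2 (volume.restrict Ω)),
      eLpNorm (fun x => u x - w x) 2 (volume.restrict Ω) ≤ min ε' 1 → edist w hu.toLp ≤ ε' := by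
    intro u w hu huw
    rw [edist_comm, Lp.edist_def]
    refine le_trans (le_of_eq (eLpNorm_congr_ae ?_)) (huw.trans (min_le_left _ _))
    filter_upwards [hu.coeFn_toLp] with x hx
    simp [hx]
  rw [Prod.edist_eq, Prod.edist_eq]
  refine max_le (hdist hF0 h1) (max_le (edist_pi_le_iff.2 fun i => hdist (hFi i) (h2 i)) ?_)
  simp

end Graph

/-! ### Green's formula and traces -/

section Green

variable {n m : ℕ} {Ω : Set (E n)} {ι : E m → E n} {S : Set (E m)}

/-- Both sides are continuous in `(p, q)`, so the identity defines a closed set and passes from test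
functions to the closure of their graph. -/
theorem green_of_testGraph {i : Fin n} {c : ℝ}
    (h : ∀ p ∈ testGraph Ω ι S, ∀ q ∈ testGraph Ω ι S,
      inner ℝ (p.2.1 i) q.1 + inner ℝ p.1 (q.2.1 i) = c * inner ℝ p.2.2 q.2.2)
    {p q : L2 Ω × (Fin n → L2 Ω) × L2 S} (hp : p ∈ sobolevGraph Ω ι S)
    (hq : q ∈ sobolevGraph Ω ι S) :
    inner ℝ (p.2.1 i) q.1 + inner ℝ p.1 (q.2.1 i) = c * inner ℝ p.2.2 q.2.2 := by
  have hcl : IsClosed {z : (L2 Ω × (Fin n → L2 Ω) × L2 S) × (L2 Ω × (Fin n → L2 Ω) × L2 S) |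
      inner ℝ (z.1.2.1 i) z.2.1 + inner ℝ z.1.1 (z.2.2.1 i)
        = c * inner ℝ z.1.2.2 z.2.2.2} := by
    apply isClosed_eq <;> fun_prop
  have hmem : (p, q) ∈ closure ((testGraph Ω ι S : Set _) ×ˢ (testGraph Ω ι S : Set _)) := by
    rw [closure_prod_eq]
    exact ⟨hp, hq⟩
  exact closure_minimal (fun z hz => h z.1 hz.1 z.2 hz.2) hcl hmem

theorem inner_add_inner_eq_setIntegral {φ ψ : E n → ℂ} (hφ : ContDiff ℝ ∞ φ)
    (hψ : ContDiff ℝ ∞ ψ) {i : Fin n} {f g df dg : L2 Ω} (hf : f =ᵐ[volume.restrict Ω] φ) (hg : g =ᵐ[volume.restrict Ω] ψ)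
    (hdf : df =ᵐ[volume.restrict Ω] fun x => fderiv ℝ φ x (EuclideanSpace.single i 1))
    (hdg : dg =ᵐ[volume.restrict Ω] fun x => fderiv ℝ ψ x (EuclideanSpace.single i 1)) :
    inner ℝ df g + inner ℝ f dg
      = ∫ x in Ω, fderiv ℝ (fun x => inner ℝ (φ x) (ψ x)) x (EuclideanSpace.single i 1) := by
  rw [L2.inner_def, L2.inner_def, ← integral_add (L2.integrable_inner _ _)
    (L2.integrable_inner _ _)]
  refine integral_congr_ae ?_
  filter_upwards [hf, hg, hdf, hdg] with x h1 h2 h3 h4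
  rw [fderiv_inner_apply ℝ (hφ.differentiable (by simp) x) (hψ.differentiable (by simp) x),
    h1, h2, h3, h4, add_comm]

theorem hasCompactSupport_inner {φ : E n → ℂ} (hφs : HasCompactSupport φ) (ψ : E n → ℂ) :
    HasCompactSupport fun x => inner ℝ (φ x) (ψ x) :=
  hφs.mono fun x hx h => hx (by simp [h])

/-- Integration by parts in a direction along which `Ω` is invariant. -/
theorem green_tangential (hΩ : MeasurableSet Ω) {i : Fin n}
    (hi : ∀ x : E n, ∀ t : ℝ, x + t • EuclideanSpace.single i 1 ∈ Ω ↔ x ∈ Ω)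
    {p q : L2 Ω × (Fin n → L2 Ω) × L2 S} (hp : p ∈ sobolevGraph Ω ι S)
    (hq : q ∈ sobolevGraph Ω ι S) :
    inner ℝ (p.2.1 i) q.1 + inner ℝ p.1 (q.2.1 i) = 0 := by
  have := green_of_testGraph (i := i) (c := 0) (fun p hp q hq => ?_) hp hq
  · rw [this, zero_mul]
  · obtain ⟨φ, h1, h2, h3, h4, -⟩ := hp
    obtain ⟨ψ, k1, k2, k3, k4, -⟩ := hq
    rw [inner_add_inner_eq_setIntegral h1 k1 h3 k3 (h4 i) (k4 i), zero_mul,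
      setIntegral_fderiv_eq_zero hΩ hi (ContDiff.inner ℝ (h1.of_le (by simp)) (k1.of_le (by simp)))
        (hasCompactSupport_inner h2 ψ)]

end Green

section HalfSpace

variable {ν : ℝ}

/-- Integration by parts in the vertical direction on a half space. -/
theorem green_vertical (hν : ν = 1 ∨ ν = -1)
    {p q : L2 (halfSpace ν) × (Fin 3 → L2 (halfSpace ν)) × L2 plane}
    (hp : p ∈ sobolevGraph (halfSpace ν) onInterface plane)
    (hq : q ∈ sobolevGraph (halfSpace ν) onInterface plane) :
    inner ℝ (p.2.1 2) q.1 + inner ℝ p.1 (q.2.1 2) = ν * inner ℝ p.2.2 q.2.2 := by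
  refine green_of_testGraph (fun p hp q hq => ?_) hp hq
  obtain ⟨φ, h1, h2, h3, h4, h5⟩ := hp
  obtain ⟨ψ, k1, k2, k3, k4, k5⟩ := hq
  rw [inner_add_inner_eq_setIntegral h1 k1 h3 k3 (h4 2) (k4 2),
    setIntegral_fderiv_vert hν (ContDiff.inner ℝ (h1.of_le (by simp)) (k1.of_le (by simp)))
      (hasCompactSupport_inner h2 ψ), L2.inner_def]
  congr 1
  refine integral_congr_ae ?_
  filter_upwards [h5, k5] with y hy1 hy2
  rw [hy1, hy2]

/-- The centre moves inwards by `2δ`, more than the radius `δ`. -/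
theorem halfSpace_cone (hν : ν = 1 ∨ ν = -1) (δ : ℝ) (hδ : 0 < δ) (x : E 3)
    (hx : x ∈ halfSpace ν) :
    Metric.closedBall (x + δ • (EuclideanSpace.single 2 (-2 * ν) : E 3)) δ ⊆ halfSpace ν := by
  intro y hy
  rw [Metric.mem_closedBall, dist_eq_norm] at hy
  have h1 := (PiLp.norm_apply_le (y - (x + δ • (EuclideanSpace.single 2 (-2 * ν) : E 3))) 2).trans hy
  rw [Real.norm_eq_abs, abs_le] at h1
  simp at h1
  have hx' : ν * x 2 < 0 := hx
  change ν * y 2 < 0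
  rcases hν with rfl | rfl <;> nlinarith

/-- Every function in the Sobolev graph of a half space has a trace. -/
theorem exists_mem_sobolevGraph_trace (hν : ν = 1 ∨ ν = -1) {f : L2 (halfSpace ν)}
    {g : Fin 3 → L2 (halfSpace ν)}
    (h : (f, g, (0 : L2 (∅ : Set (E 2)))) ∈ sobolevGraph (halfSpace ν) onInterface ∅) :
    ∃ τ : L2 plane, (f, g, τ) ∈ sobolevGraph (halfSpace ν) onInterface plane := by
  obtain ⟨p, hp, hlim⟩ := mem_closure_iff_seq_limit.1 h
  choose φ hφ hφs h1 h2 _ using hp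
  -- A closed embedding pulls compact supports back to compact supports, so the restricted test
  -- functions are in `L²` of the plane.
  have hemb : IsClosedEmbedding onInterface := by
    refine Topology.IsClosedEmbedding.of_continuous_injective_isClosedMap continuous_onInterface
      ?_ ?_
    · intro y z hyz
      have := congrArg horiz hyz
      rwa [← joinVert_zero, ← joinVert_zero, horiz_joinVert, horiz_joinVert] at this
    · have hiso : Isometry onInterface := by
        refine Isometry.of_dist_eq fun y z => ?_
        simp [EuclideanSpace.dist_eq, onInterface, Fin.sum_univ_succ]
      exact hiso.isClosedEmbedding.isClosedMap
  have hmem : ∀ k, MemLp (fun y => φ k (onInterface y)) 2 (volume.restrict plane) := fun k =>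
    ((hφ k).continuous.comp continuous_onInterface).memLp_of_hasCompactSupport
      ((hφs k).comp_isClosedEmbedding hemb)
  set T : ℕ → L2 plane := fun k => (hmem k).toLp with hT
  have hq : ∀ k, ((p k).1, (p k).2.1, T k) ∈ testGraph (halfSpace ν) onInterface plane :=
    fun k => ⟨φ k, hφ k, hφs k, h1 k, h2 k, (hmem k).coeFn_toLp⟩
  -- The trace inequality is Green's formula with both arguments equal. Applied to differences it
  -- makes the traces of the approximants a Cauchy sequence.
  have hbound : ∀ q ∈ testGraph (halfSpace ν) onInterface plane,
      ‖q.2.2‖ ^ 2 ≤ 2 * (‖q.2.1 2‖ * ‖q.1‖) := by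
    intro q hq
    have hq' := subset_closure hq
    have hG := green_vertical hν hq' hq'
    have hn : ‖ν * inner ℝ q.2.2 q.2.2‖ = ‖q.2.2‖ ^ 2 := by
      rw [norm_mul, real_inner_self_eq_norm_sq]
      rcases hν with rfl | rfl <;> simp
    rw [← hn, ← hG]
    refine (norm_add_le _ _).trans ?_
    have := norm_inner_le_norm (𝕜 := ℝ) (q.2.1 2) q.1
    have := norm_inner_le_norm (𝕜 := ℝ) q.1 (q.2.1 2)
    linarith
  have hlim1 : CauchySeq fun k => (p k).1 := (hlim.fst_nhds).cauchySeq
  have hlim2 : CauchySeq fun k => (p k).2.1 2 :=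
    (tendsto_pi_nhds.1 hlim.snd_nhds.fst_nhds 2).cauchySeq
  have hT' : CauchySeq T := by
    rw [Metric.cauchySeq_iff] at hlim1 hlim2 ⊢
    intro ε hε
    obtain ⟨N1, hN1⟩ := hlim1 (ε / 2) (by positivity)
    obtain ⟨N2, hN2⟩ := hlim2 (ε / 2) (by positivity)
    refine ⟨max N1 N2, fun k hk l hl => ?_⟩
    have h3 := hbound _ ((testGraph _ _ _).sub_mem (hq k) (hq l))
    have h4 := hN1 k (le_of_max_le_left hk) l (le_of_max_le_left hl)
    have h5 := hN2 k (le_of_max_le_right hk) l (le_of_max_le_right hl)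
    rw [dist_eq_norm] at h4 h5 ⊢
    simp only [Prod.fst_sub, Prod.snd_sub, Pi.sub_apply] at h3
    have h6 : ‖(p k).2.1 2 - (p l).2.1 2‖ * ‖(p k).1 - (p l).1‖ ≤ (ε / 2) * (ε / 2) :=
      mul_le_mul h5.le h4.le (norm_nonneg _) (by positivity)
    refine lt_of_pow_lt_pow_left₀ 2 hε.le ?_
    nlinarith
  obtain ⟨τ, hτ⟩ := cauchySeq_tendsto_of_complete hT'
  exact ⟨τ, mem_sobolevGraph_of_tendsto hlim.fst_nhds
    (fun i => tendsto_pi_nhds.1 hlim.snd_nhds.fst_nhds i) hτ hq⟩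

end HalfSpace

/-! ### Comparison with the definitions of weak derivatives and traces -/

section Compare

variable {n : ℕ} {Ω : Set (E n)}

theorem hasWeakPartial_weakPartial {f : L2 Ω} (hf : MemW1 Ω f) (i : Fin n) :
    HasWeakPartial Ω i f (weakPartial Ω i f) := by
  rw [weakPartial, dif_pos (hf i)]
  exact (hf i).choose_spec

theorem tendsto_toLp_of_tendsto_eLpNorm {φ : ℕ → E n → ℂ}
    (hφ : ∀ k, MemLp (φ k) 2 (volume.restrict Ω)) {f : L2 Ω}
    (h : Tendsto (fun k => eLpNorm (fun x => φ k x - f x) 2 (volume.restrict Ω)) atTop (𝓝 0)) :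
    Tendsto (fun k => (hφ k).toLp) atTop (𝓝 f) := by
  have := (Lp.tendsto_Lp_iff_tendsto_eLpNorm'' φ hφ f (Lp.memLp f)).2 h
  rwa [Lp.toLp_coeFn] at this

theorem memLp_fderiv_of_hasCompactSupport {φ : E n → ℂ} (hφ : ContDiff ℝ ∞ φ)
    (hφs : HasCompactSupport φ) (v : E n) (μ : Measure (E n)) [IsLocallyFiniteMeasure μ] :
    MemLp (fun x => fderiv ℝ φ x v) 2 μ :=
  ((hφ.continuous_fderiv (by simp)).clm_apply continuous_const).memLp_of_hasCompactSupport
    (hφs.fderiv_apply ℝ v)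

theorem memLp_of_eLpNorm_sub {φ : ℕ → E n → ℂ} {f : L2 Ω}
    (hm : ∀ k, AEStronglyMeasurable (φ k) (volume.restrict Ω))
    (h : Tendsto (fun k => eLpNorm (fun x => φ k x - f x) 2 (volume.restrict Ω)) atTop (𝓝 0)) :
    ∀ᶠ k in atTop, MemLp (φ k) 2 (volume.restrict Ω) := by
  filter_upwards [h.eventually (gt_mem_nhds one_pos)] with k hk
  have h3 : MemLp (fun x => φ k x - f x) 2 (volume.restrict Ω) :=
    ⟨(hm k).sub (Lp.aestronglyMeasurable f), hk.trans ENNReal.one_lt_top⟩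
  refine (h3.add (Lp.memLp f)).congr_norm (hm k) (Eventually.of_forall fun x => ?_)
  simp

end Compare

section Membership

variable {ν : ℝ}

theorem mem_sobolevGraph_of_tendstoW1 {Ω : Set (E 3)} {f : L2 Ω} {h : L2 plane}
    {φ : ℕ → E 3 → ℂ} (hφ : ∀ k, ContDiff ℝ ∞ (φ k) ∧ HasCompactSupport (φ k))
    (hW : TendstoW1 Ω φ f)
    (hh : Tendsto (fun k => eLpNorm (fun y => φ k (onInterface y) - h y) 2
      (volume.restrict plane)) atTop (𝓝 0)) :
    (f, fun i => weakPartial Ω i f, h) ∈ sobolevGraph Ω onInterface plane := by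
  have hev := memLp_of_eLpNorm_sub (φ := fun k y => φ k (onInterface y)) (fun k =>
    ((hφ k).1.continuous.comp continuous_onInterface).aestronglyMeasurable) hh
  obtain ⟨N, hN⟩ := eventually_atTop.1 hev
  have hm1 : ∀ k, MemLp (φ (k + N)) 2 (volume.restrict Ω) := fun k =>
    (hφ _).1.continuous.memLp_of_hasCompactSupport (hφ _).2
  have hm2 : ∀ i : Fin 3, ∀ k, MemLp
      (fun x => fderiv ℝ (φ (k + N)) x (EuclideanSpace.single i 1)) 2 (volume.restrict Ω) :=
    fun i k => memLp_fderiv_of_hasCompactSupport (hφ _).1 (hφ _).2 _ _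
  have hm3 : ∀ k, MemLp (fun y => φ (k + N) (onInterface y)) 2 (volume.restrict plane) :=
    fun k => hN _ (Nat.le_add_left _ _)
  have hshift := tendsto_add_atTop_nat N
  refine mem_sobolevGraph_of_tendsto (tendsto_toLp_of_tendsto_eLpNorm hm1 (hW.1.comp hshift))
    (G := fun k i => (hm2 i k).toLp)
    (fun i => tendsto_toLp_of_tendsto_eLpNorm (hm2 i) ((hW.2 i).comp hshift))
    (tendsto_toLp_of_tendsto_eLpNorm hm3 (hh.comp hshift)) fun k => ?_
  exact ⟨φ (k + N), (hφ _).1, (hφ _).2, (hm1 k).coeFn_toLp, fun i => (hm2 i k).coeFn_toLp,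
    (hm3 k).coeFn_toLp⟩

/-- The approximating test functions are supported in the open half space, hence vanish on the
interface. -/
theorem mem_sobolevGraph_of_memW10 {f : L2 (halfSpace ν)}
    (hf : MemW10 (halfSpace ν) f) :
    (f, fun i => weakPartial (halfSpace ν) i f, 0)
      ∈ sobolevGraph (halfSpace ν) onInterface plane := by
  obtain ⟨-, φ, hφ, hW⟩ := hf
  refine mem_sobolevGraph_of_tendstoW1 (fun k => ⟨(hφ k).1, (hφ k).2.1⟩) hW ?_
  have h0 : ∀ k, eLpNorm (fun y => φ k (onInterface y) - (0 : L2 plane) y) 2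
      (volume.restrict plane) = 0 := fun k => by
    rw [eLpNorm_eq_zero_iff _ (by simp)]
    · filter_upwards [Lp.coeFn_zero ℂ 2 (volume.restrict plane)] with y hy
      rw [hy]
      have : onInterface y ∉ halfSpace ν := by simp [onInterface]
      have h2 : onInterface y ∉ tsupport (φ k) := fun h => this ((hφ k).2.2 h)
      simp [image_eq_zero_of_notMem_tsupport h2]
    · exact ((hφ k).1.continuous.comp continuous_onInterface).aestronglyMeasurable.sub
        (Lp.aestronglyMeasurable _)
  simp only [h0]
  exact tendsto_const_nhds

/-- Traces of `W^{1,2}` functions on a half space exist. -/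
theorem exists_hasTrace (hν : ν = 1 ∨ ν = -1) {f : L2 (halfSpace ν)}
    (hf : MemW1 (halfSpace ν) f) : ∃ h, HasTrace (halfSpace ν) f h := by
  have h1 := mem_sobolevGraph_of_hasWeakPartial (measurableSet_halfSpace ν) (halfSpace_cone hν)
    continuous_onInterface (hasWeakPartial_weakPartial hf)
  obtain ⟨τ, hτ⟩ := exists_mem_sobolevGraph_trace hν h1
  refine ⟨τ, hf, ?_⟩
  obtain ⟨p, hp, hlim⟩ := mem_closure_iff_seq_limit.1 hτ
  choose φ hφ hφs h1 h2 h3 using hp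
  have key : ∀ {k : ℕ} {Ω : Set (E k)} {u : ℕ → L2 Ω} {w : L2 Ω} {ψ : ℕ → E k → ℂ},
      Tendsto u atTop (𝓝 w) → (∀ k, u k =ᵐ[volume.restrict Ω] ψ k) →
      Tendsto (fun k => eLpNorm (fun x => ψ k x - w x) 2 (volume.restrict Ω)) atTop (𝓝 0) := by
    intro k Ω u w ψ huw hψ
    have := (Lp.tendsto_Lp_iff_tendsto_eLpNorm' u w).1 huw
    refine this.congr fun k => eLpNorm_congr_ae ?_
    filter_upwards [hψ k] with x hx
    simp [hx]
  exact ⟨φ, fun k => ⟨hφ k, hφs k⟩, ⟨key hlim.fst_nhds h1, fun i =>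
    key (tendsto_pi_nhds.1 hlim.snd_nhds.fst_nhds i) fun k => h2 k i⟩,
    key hlim.snd_nhds.snd_nhds h3⟩

/-- Uniqueness of traces is not needed: whichever value is chosen comes with an approximating
sequence that puts it in the graph. -/
theorem mem_sobolevGraph_trace (hν : ν = 1 ∨ ν = -1) {f : L2 (halfSpace ν)}
    (hf : MemW1 (halfSpace ν) f) :
    (f, fun i => weakPartial (halfSpace ν) i f, trace (halfSpace ν) f)
      ∈ sobolevGraph (halfSpace ν) onInterface plane := by
  have h := exists_hasTrace hν hf
  rw [trace, dif_pos h]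
  obtain ⟨-, φ, hφ, hW, hT⟩ := h.choose_spec
  exact mem_sobolevGraph_of_tendstoW1 hφ hW hT

theorem mem_sobolevGraph_plane {s : L2 plane} (hs : MemW1 plane s) :
    (s, fun i => weakPartial plane i s, (0 : L2 (∅ : Set (E 2)))) ∈ sobolevGraph plane id ∅ :=
  mem_sobolevGraph_of_hasWeakPartial MeasurableSet.univ (a := 0)
    (fun _ _ _ _ => subset_univ _) continuous_id (hasWeakPartial_weakPartial hs)

end Membership

/-! ### The exponential lifting of functions on the interface -/

section Lift

variable {Ω : Set (E 3)} {ν β : ℝ}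

theorem lintegral_exp_halfLine_lt_top (hν : ν = 1 ∨ ν = -1) (hβ : 0 < β) :
    ∫⁻ t in halfLine ν, ‖Real.exp (ν * β * t)‖ₑ ^ (2 : ℝ) < ⊤ := by
  have hint : IntegrableOn (fun t => Real.exp (2 * ν * β * t)) (halfLine ν) := by
    rcases hν with rfl | rfl
    · refine (integrableOn_exp_mul_Iic (by positivity) 0).mono_set fun t ht => ?_
      have : (1 : ℝ) * t < 0 := ht
      exact (by linarith : t ≤ 0)
    · refine (integrableOn_exp_mul_Ioi (by linarith) 0).mono_set fun t ht => ?_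
      have : (-1 : ℝ) * t < 0 := ht
      exact (by linarith : 0 < t)
  refine lt_of_eq_of_lt (lintegral_congr fun t => ?_) hint.2
  rw [ENNReal.rpow_two, ← enorm_pow, ← Real.exp_nat_mul]
  congr 2
  push_cast
  ring

/-- The norm bound for the exponential lifting. -/
def expLiftBound (ν β : ℝ) : ENNReal :=
  (∫⁻ t in halfLine ν, ‖Real.exp (ν * β * t)‖ₑ ^ (2 : ℝ)) ^ (1 / 2 : ℝ)

theorem expLiftBound_lt_top (hν : ν = 1 ∨ ν = -1) (hβ : 0 < β) : expLiftBound ν β < ⊤ :=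
  ENNReal.rpow_lt_top_of_nonneg (by norm_num) (lintegral_exp_halfLine_lt_top hν hβ).ne

theorem aestronglyMeasurable_expLift (hΩ : Ω = halfSpace ν) (s : L2 plane) :
    AEStronglyMeasurable (fun x : E 3 => Real.exp (ν * β * x 2) • s (horiz x))
      (volume.restrict Ω) := by
  subst hΩ
  have h1 : Continuous fun x : E 3 => Real.exp (ν * β * x 2) := by fun_prop
  exact h1.aestronglyMeasurable.smul ((Lp.aestronglyMeasurable s).comp_quasiMeasurePreserving
    (quasiMeasurePreserving_horiz ν))

/-- In the coordinates `joinVert` the integrand is a product of a function of `x_h` and one of `x₃`,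
so the norm factors. -/
theorem eLpNorm_expLift (hΩ : Ω = halfSpace ν) {s : E 2 → ℂ}
    (hsm : AEStronglyMeasurable s (volume.restrict plane)) :
    eLpNorm (fun x : E 3 => Real.exp (ν * β * x 2) • s (horiz x)) 2 (volume.restrict Ω)
      = expLiftBound ν β * eLpNorm s 2 (volume.restrict plane) := by
  subst hΩ
  rw [eLpNorm_eq_lintegral_rpow_enorm_toReal (by simp) (by simp),
    eLpNorm_eq_lintegral_rpow_enorm_toReal (by simp) (by simp), expLiftBound,
    ← (measurePreserving_joinVert_halfSpace ν).lintegral_comp_emb joinVert.measurableEmbedding]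
  simp only [horiz_joinVert, joinVert_apply_two, enorm_smul, ENNReal.toReal_ofNat]
  rw [← ENNReal.mul_rpow_of_nonneg _ _ (by norm_num)]
  congr 1
  simp_rw [ENNReal.mul_rpow_of_nonneg _ _ (zero_le_two : (0 : ℝ) ≤ 2),
    mul_comm (‖Real.exp _‖ₑ ^ (2 : ℝ))]
  have hs : AEMeasurable (fun y => ‖s y‖ₑ ^ (2 : ℝ)) (volume : Measure (E 2)) := by
    have := (hsm.enorm).pow_const (2 : ℝ)
    rwa [Measure.restrict_univ] at this
  have hexp : Measurable fun t : ℝ => ‖Real.exp (ν * β * t)‖ₑ ^ (2 : ℝ) := by fun_prop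
  rw [lintegral_prod_mul (f := fun y => ‖s y‖ₑ ^ (2 : ℝ))
    (g := fun t => ‖Real.exp (ν * β * t)‖ₑ ^ (2 : ℝ)) hs hexp.aemeasurable, mul_comm,
    Measure.restrict_univ]

theorem memLp_expLift (hΩ : Ω = halfSpace ν) (hν : ν = 1 ∨ ν = -1) (hβ : 0 < β) (s : L2 plane) :
    MemLp (fun x : E 3 => Real.exp (ν * β * x 2) • s (horiz x)) 2 (volume.restrict Ω) := by
  refine ⟨aestronglyMeasurable_expLift hΩ s, ?_⟩
  rw [eLpNorm_expLift hΩ (Lp.aestronglyMeasurable s)]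
  exact ENNReal.mul_lt_top (expLiftBound_lt_top hν hβ) (Lp.memLp s).2

/-- The lifting `s ↦ s(x_h) exp(ν β x₃)` from the interface to a half space. -/
def expLift (hΩ : Ω = halfSpace ν) (hν : ν = 1 ∨ ν = -1) (hβ : 0 < β) :
    L2 plane →L[ℝ] L2 Ω :=
  LinearMap.mkContinuous
    { toFun := fun s => (memLp_expLift hΩ hν hβ s).toLp
      map_add' := fun s r => by
        rw [← MemLp.toLp_add]
        refine MemLp.toLp_congr _ _ ?_
        subst hΩ
        filter_upwards [(quasiMeasurePreserving_horiz ν).ae_eq_comp (Lp.coeFn_add s r)] with x hx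
        simp only [Function.comp_apply, Pi.add_apply] at hx
        simp only [Pi.add_apply, hx, smul_add]
      map_smul' := fun c s => by
        rw [RingHom.id_apply, ← MemLp.toLp_const_smul]
        refine MemLp.toLp_congr _ _ ?_
        subst hΩ
        filter_upwards [(quasiMeasurePreserving_horiz ν).ae_eq_comp (Lp.coeFn_smul c s)] with x hx
        simp only [Function.comp_apply, Pi.smul_apply] at hx
        simp only [Pi.smul_apply, hx]
        rw [smul_comm] }
    (expLiftBound ν β).toReal fun s => by
      change ‖(memLp_expLift hΩ hν hβ s).toLp‖ ≤ _
      rw [Lp.norm_toLp, eLpNorm_expLift hΩ (Lp.aestronglyMeasurable s), ENNReal.toReal_mul, Lp.norm_def]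

theorem coeFn_expLift (hΩ : Ω = halfSpace ν) (hν : ν = 1 ∨ ν = -1) (hβ : 0 < β) (s : L2 plane) :
    expLift hΩ hν hβ s =ᵐ[volume.restrict Ω] fun x => Real.exp (ν * β * x 2) • s (horiz x) :=
  (memLp_expLift hΩ hν hβ s).coeFn_toLp

/-- The horizontal projection as a continuous linear map. -/
def horizL : E 3 →L[ℝ] E 2 :=
  LinearMap.toContinuousLinearMap
    { toFun := horiz
      map_add' := fun x y => by ext i; fin_cases i <;> simp [horiz]
      map_smul' := fun c x => by ext i; fin_cases i <;> simp [horiz] }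

theorem horizL_single_zero : horizL (EuclideanSpace.single 0 1) = EuclideanSpace.single 0 1 := by
  ext i; fin_cases i <;> simp [horizL, horiz]

theorem horizL_single_one : horizL (EuclideanSpace.single 1 1) = EuclideanSpace.single 1 1 := by
  ext i; fin_cases i <;> simp [horizL, horiz]

theorem horizL_single_two : horizL (EuclideanSpace.single 2 1) = 0 := by
  ext i; fin_cases i <;> simp [horizL, horiz]

theorem hasFDerivAt_exp_smul_horiz {φ : E 2 → ℂ} (hφ : ContDiff ℝ ∞ φ) (x : E 3) :
    HasFDerivAt (fun x : E 3 => Real.exp (ν * β * x 2) • φ (horiz x))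
      (Real.exp (ν * β * x 2) • (fderiv ℝ φ (horiz x)).comp horizL
        + ((Real.exp (ν * β * x 2) * (ν * β)) •
            (EuclideanSpace.proj 2 : E 3 →L[ℝ] ℝ)).smulRight (φ (horiz x))) x := by
  have h1 : HasFDerivAt (fun x : E 3 => φ (horiz x)) ((fderiv ℝ φ (horiz x)).comp horizL) x :=
    (hφ.differentiable (by simp) (horiz x)).hasFDerivAt.comp x horizL.hasFDerivAt
  have h2 : HasFDerivAt (fun x : E 3 => Real.exp (ν * β * x 2))
      ((Real.exp (ν * β * x 2) * (ν * β)) • (EuclideanSpace.proj 2 : E 3 →L[ℝ] ℝ)) x := by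
    have h3 : HasFDerivAt (fun x : E 3 => ν * β * x 2)
        ((ν * β) • (EuclideanSpace.proj 2 : E 3 →L[ℝ] ℝ)) x :=
      ((EuclideanSpace.proj 2 : E 3 →L[ℝ] ℝ).hasFDerivAt).const_mul (ν * β)
    have := h3.exp
    rwa [smul_smul] at this
  exact h2.smul h1

/-- The exponential lifting maps `W^{1,2}` of the interface to `W^{1,2}` of the half space, and its
trace is the original function. -/
theorem mem_sobolevGraph_expLift (hΩ : Ω = halfSpace ν) (hν : ν = 1 ∨ ν = -1) (hβ : 0 < β)
    {s : L2 plane} {ds : Fin 2 → L2 plane}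
    (hs : (s, ds, (0 : L2 (∅ : Set (E 2)))) ∈ sobolevGraph plane id ∅) :
    (expLift hΩ hν hβ s, ![expLift hΩ hν hβ (ds 0), expLift hΩ hν hβ (ds 1),
      (ν * β) • expLift hΩ hν hβ s], s) ∈ sobolevGraph Ω onInterface plane := by
  obtain ⟨p, hp, hlim⟩ := mem_closure_iff_seq_limit.1 hs
  choose φ hφ hφs h1 h2 _ using hp
  set ex := expLift hΩ hν hβ with hex
  have l1 := hlim.fst_nhds
  have l2 := tendsto_pi_nhds.1 hlim.snd_nhds.fst_nhds
  have hcl : IsClosed (sobolevGraph Ω onInterface plane :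
      Set (L2 Ω × (Fin 3 → L2 Ω) × L2 plane)) := Submodule.isClosed_topologicalClosure _
  refine hcl.mem_of_tendsto (b := atTop) (f := fun k => (ex (p k).1,
    ![ex ((p k).2.1 0), ex ((p k).2.1 1), (ν * β) • ex (p k).1], (p k).1)) ?_
    (Eventually.of_forall fun k => ?_)
  · refine ((ex.continuous.tendsto _).comp l1).prodMk_nhds
      ((tendsto_pi_nhds.2 fun i => ?_).prodMk_nhds l1)
    fin_cases i
    · exact (ex.continuous.tendsto _).comp (l2 0)
    · exact (ex.continuous.tendsto _).comp (l2 1)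
    · exact ((ex.continuous.tendsto _).comp l1).const_smul (ν * β)
  · have hq : Measure.QuasiMeasurePreserving horiz (volume.restrict Ω) (volume.restrict plane) := by
      rw [hΩ]; exact quasiMeasurePreserving_horiz ν
    -- The lift of a test function is smooth but not compactly supported in the vertical direction,
    -- so it enters through `mem_sobolevGraph_of_contDiff` and its cutoffs.
    have hF : ContDiff ℝ ∞ fun x : E 3 => Real.exp (ν * β * x 2) • φ k (horiz x) :=
      ContDiff.smul (f := fun x : E 3 => Real.exp (ν * β * x 2)) (by fun_prop) ((hφ k).comp horizL.contDiff)
    refine mem_sobolevGraph_of_contDiff continuous_onInterface hF ?_ (fun i => ?_) ?_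
    · filter_upwards [coeFn_expLift hΩ hν hβ (p k).1, hq.ae_eq_comp (h1 k)] with x hx1 hx2
      simp only [Function.comp_apply] at hx2
      rw [hx1, hx2]
    · simp only [(hasFDerivAt_exp_smul_horiz (hφ k) _).fderiv]
      fin_cases i
      · filter_upwards [coeFn_expLift hΩ hν hβ ((p k).2.1 0), hq.ae_eq_comp (h2 k 0)]
          with x hx1 hx2
        simp only [Function.comp_apply] at hx2
        simp [hex, hx1, hx2, horizL_single_zero]
      · filter_upwards [coeFn_expLift hΩ hν hβ ((p k).2.1 1), hq.ae_eq_comp (h2 k 1)]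
          with x hx1 hx2
        simp only [Function.comp_apply] at hx2
        simp [hex, hx1, hx2, horizL_single_one]
      · filter_upwards [coeFn_expLift hΩ hν hβ (p k).1, hq.ae_eq_comp (h1 k),
          Lp.coeFn_smul (ν * β) (ex (p k).1)] with x hx1 hx2 hx3
        simp only [Function.comp_apply] at hx2
        have : (![ex ((p k).2.1 0), ex ((p k).2.1 1), (ν * β) • ex (p k).1] : Fin 3 → L2 Ω) 2
          = (ν * β) • ex (p k).1 := rfl
        simp only [Fin.reduceFinMk, this]
        rw [hx3, Pi.smul_apply, hx1, hx2]
        simp [horizL_single_two]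
        ring
    · filter_upwards [h1 k] with y hy
      rw [hy]
      have : horiz (onInterface y) = y := by rw [← joinVert_zero, horiz_joinVert]
      rw [this]
      simp [onInterface]

end Lift

/-! ### The energy inequality -/

/-- `l = Δa` and `τ` is the trace of `∂₃a`, for `a` with zero trace. -/
def DirichletData (Ω : Set (E 3)) (a l : L2 Ω) (τ : L2 plane) : Prop :=
  ∃ (da : Fin 3 → L2 Ω) (dda : Fin 3 → Fin 3 → L2 Ω) (σ : Fin 3 → L2 plane),
    (a, da, 0) ∈ sobolevGraph Ω onInterface plane ∧
    (∀ i, (da i, dda i, σ i) ∈ sobolevGraph Ω onInterface plane) ∧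
    l = ∑ i, dda i i ∧ τ = σ 2

/-- `l = Δs` on the plane. -/
def PlaneData (s l : L2 plane) : Prop :=
  ∃ (ds : Fin 2 → L2 plane) (dds : Fin 2 → Fin 2 → L2 plane),
    (s, ds, (0 : L2 (∅ : Set (E 2)))) ∈ sobolevGraph plane id ∅ ∧
    (∀ i, (ds i, dds i, (0 : L2 (∅ : Set (E 2)))) ∈ sobolevGraph plane id ∅) ∧
    l = ∑ i, dds i i

/-- Membership in a subspace is linear, so differences are handled without knowing that the chosen
weak derivatives, Laplacians and traces are additive. -/
theorem DirichletData.sub {Ω : Set (E 3)} {a l a' l' : L2 Ω} {τ τ' : L2 plane}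
    (h : DirichletData Ω a l τ) (h' : DirichletData Ω a' l' τ') :
    DirichletData Ω (a - a') (l - l') (τ - τ') := by
  obtain ⟨da, dda, σ, h1, h2, rfl, rfl⟩ := h
  obtain ⟨da', dda', σ', k1, k2, rfl, rfl⟩ := h'
  refine ⟨da - da', dda - dda', σ - σ', ?_, fun i => Submodule.sub_mem _ (h2 i) (k2 i), ?_, rfl⟩
  · have := Submodule.sub_mem _ h1 k1
    rwa [Prod.mk_sub_mk, Prod.mk_sub_mk, sub_zero] at this
  · simp [Finset.sum_sub_distrib]

theorem PlaneData.sub {s l s' l' : L2 plane} (h : PlaneData s l) (h' : PlaneData s' l') :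
    PlaneData (s - s') (l - l') := by
  obtain ⟨ds, dds, h1, h2, rfl⟩ := h
  obtain ⟨ds', dds', k1, k2, rfl⟩ := h'
  refine ⟨ds - ds', dds - dds', ?_, fun i => ?_, ?_⟩
  · have := Submodule.sub_mem _ h1 k1
    rwa [Prod.mk_sub_mk, Prod.mk_sub_mk, sub_zero] at this
  · have := Submodule.sub_mem _ (h2 i) (k2 i)
    rwa [Prod.mk_sub_mk, Prod.mk_sub_mk, sub_zero] at this
  · simp [Finset.sum_sub_distrib]

theorem dirichletData_of_memW2 {Ω : Set (E 3)} {ν : ℝ} (hΩ : Ω = halfSpace ν)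
    (hν : ν = 1 ∨ ν = -1) {a : L2 Ω} (h0 : MemW10 Ω a) (h2 : MemW2 Ω a) :
    DirichletData Ω a (laplacian Ω a) (trace Ω (weakPartial Ω 2 a)) := by
  subst hΩ
  exact ⟨_, _, fun i => trace (halfSpace ν) (weakPartial (halfSpace ν) i a),
    mem_sobolevGraph_of_memW10 h0, fun i => mem_sobolevGraph_trace hν (h2.2 i), rfl, rfl⟩

theorem planeData_of_memW2 {s : L2 plane} (h : MemW2 plane s) :
    PlaneData s (laplacian plane s) :=
  ⟨_, _, mem_sobolevGraph_plane h.1, fun i => mem_sobolevGraph_plane (h.2 i), rfl⟩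

/-- Integration by parts on the whole plane gives `⟪Δs, s⟫ = -‖∇s‖²`. -/
theorem PlaneData.inner_nonpos {s l : L2 plane} (h : PlaneData s l) : inner ℝ l s ≤ 0 := by
  obtain ⟨ds, dds, h1, h2, rfl⟩ := h
  rw [sum_inner]
  refine Finset.sum_nonpos fun i _ => ?_
  have hG := green_tangential (i := i) MeasurableSet.univ (fun _ _ => by simp) (h2 i) h1
  have := real_inner_self_nonneg (x := ds i)
  simp only at hG
  linarith

/-- Green's formula for `u = a + s(x_h) exp(ν β x₃)`, whose trace is `s`. -/
theorem inner_laplacian_add_expLift_le {Ω : Set (E 3)} {ν β : ℝ} (hΩ : Ω = halfSpace ν)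
    (hν : ν = 1 ∨ ν = -1) (hβ : 0 < β) {a l : L2 Ω} {τ s ls : L2 plane}
    (ha : DirichletData Ω a l τ) (hs : PlaneData s ls) :
    inner ℝ (l + expLift hΩ hν hβ (ls + β ^ 2 • s)) (a + expLift hΩ hν hβ s)
      ≤ ν * inner ℝ τ s + β * inner ℝ s s := by
  obtain ⟨da, dda, σ, h1, h2, rfl, rfl⟩ := ha
  obtain ⟨ds, dds, k1, k2, rfl⟩ := hs
  set ex := expLift hΩ hν hβ with hex
  have hlift := fun {s ds} => mem_sobolevGraph_expLift (s := s) (ds := ds) hΩ hν hβ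
  -- `hU` is the triple of `u` itself, with trace `s`; `hD0`, `hD1`, `hD2` are the triples of its
  -- partial derivatives, the last with trace `τ + νβ s`.
  have hU := Submodule.add_mem _ h1 (hlift k1)
  have hD0 := Submodule.add_mem _ (h2 0) (hlift (k2 0))
  have hD1 := Submodule.add_mem _ (h2 1) (hlift (k2 1))
  have hD2 := Submodule.add_mem _ (h2 2) (Submodule.smul_mem _ (ν * β) (hlift k1))
  have hν2 : ν * ν = 1 := by rcases hν with rfl | rfl <;> norm_num
  rw [← hex] at hU hD0 hD1 hD2
  clear_value ex
  subst hΩ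
  have hm := measurableSet_halfSpace ν
  have g0 := green_tangential (i := 0) hm (fun x t => by simp) hD0 hU
  have g1 := green_tangential (i := 1) hm (fun x t => by simp) hD1 hU
  have g2 := green_vertical hν hD2 hU
  simp only [Prod.mk_add_mk, Prod.smul_mk, Pi.add_apply, Pi.smul_apply, Matrix.cons_val_zero,
    Matrix.cons_val_one, Matrix.cons_val, zero_add] at g0 g1 g2
  have n0 := real_inner_self_nonneg (x := da 0 + ex (ds 0))
  have n1 := real_inner_self_nonneg (x := da 1 + ex (ds 1))
  have n2 := real_inner_self_nonneg (x := da 2 + (ν * β) • ex s)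
  -- As `(νβ)² = β²`, the vertical second derivative of the lifting supplies the `β² s` term, and
  -- the left argument is exactly `Δu`.
  have hsum : (∑ i, dda i i) + ex (∑ i, dds i i + β ^ 2 • s)
      = (dda 0 0 + ex (dds 0 0)) + (dda 1 1 + ex (dds 1 1))
        + (dda 2 2 + (ν * β) • (ν * β) • ex s) := by
    rw [smul_smul, show ν * β * (ν * β) = β ^ 2 by linear_combination β ^ 2 * hν2]
    rw [Fin.sum_univ_three, Fin.sum_univ_two, map_add, map_add, map_smul]
    abel
  have hτ : ν * inner ℝ (σ 2 + (ν * β) • s) s = ν * inner ℝ (σ 2) s + β * inner ℝ s s := by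
    rw [inner_add_left, real_inner_smul_left]
    linear_combination β * inner ℝ s s * hν2
  rw [hsum, inner_add_left, inner_add_left, ← hτ, ← g2]
  linarith

/-- The bulk equation in terms of the lifting of the interface unknown. -/
theorem add_expLift_eq_of_ae {Ω : Set (E 3)} {ν β κ : ℝ} (hΩ : Ω = halfSpace ν)
    (hν : ν = 1 ∨ ν = -1) (hβ : 0 < β) {w l : L2 Ω} {p q r : L2 plane}
    (h : (w + -(κ • l) : L2 Ω) =ᵐ[volume.restrict Ω] fun x =>
      (-(p (horiz x)) + κ * q (horiz x) + β ^ 2 * κ * r (horiz x)) * Real.exp (ν * β * x 2)) :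
    w + expLift hΩ hν hβ p = κ • (l + expLift hΩ hν hβ (q + β ^ 2 • r)) := by
  have key : w + -(κ • l) = expLift hΩ hν hβ (-p + κ • q + (β ^ 2 * κ) • r) := by
    refine Lp.ext (h.trans ?_)
    have hq : Measure.QuasiMeasurePreserving horiz (volume.restrict Ω) (volume.restrict plane) := by
      rw [hΩ]; exact quasiMeasurePreserving_horiz ν
    filter_upwards [coeFn_expLift hΩ hν hβ (-p + κ • q + (β ^ 2 * κ) • r),
      hq.ae_eq_comp (Lp.coeFn_add (-p + κ • q) ((β ^ 2 * κ) • r)),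
      hq.ae_eq_comp (Lp.coeFn_add (-p) (κ • q)), hq.ae_eq_comp (Lp.coeFn_neg p),
      hq.ae_eq_comp (Lp.coeFn_smul κ q), hq.ae_eq_comp (Lp.coeFn_smul (β ^ 2 * κ) r)]
      with x hx1 hx2 hx3 hx4 hx5 hx6
    simp only [Function.comp_apply, Pi.add_apply, Pi.neg_apply, Pi.smul_apply]
      at hx2 hx3 hx4 hx5 hx6
    rw [hx1, hx2, hx3, hx4, hx5, hx6]
    simp only [Complex.real_smul]
    push_cast
    ring
  have : w = expLift hΩ hν hβ (-p + κ • q + (β ^ 2 * κ) • r) + κ • l := by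
    rw [← key]; abel
  rw [this]
  simp only [map_add, map_neg, map_smul, smul_add, smul_smul]
  rw [mul_comm κ]
  abel

/-- The change of variables `v ↦ (v_A + v_S e^{-βx₃}, v_B + v_S e^{βx₃}, √α_S v_S)`. -/
def undo {β : ℝ} (hβ : 0 < β) (αS : ℝ) : H →L[ℝ] H :=
  let πA : H →L[ℝ] L2 upper := WithLp.fstL 2 ℝ _ _
  let πB : H →L[ℝ] L2 lower := (WithLp.fstL 2 ℝ _ _).comp (WithLp.sndL 2 ℝ _ _)
  let πS : H →L[ℝ] L2 plane := (WithLp.sndL 2 ℝ _ _).comp (WithLp.sndL 2 ℝ _ _)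
  (WithLp.prodContinuousLinearEquiv 2 ℝ (L2 upper)
    (WithLp 2 (L2 lower × L2 plane))).symm.toContinuousLinearMap.comp
    ((πA + (expLift upper_eq_halfSpace (Or.inr rfl) hβ).comp πS).prod
      ((WithLp.prodContinuousLinearEquiv 2 ℝ (L2 lower) (L2 plane)).symm.toContinuousLinearMap.comp
        ((πB + (expLift lower_eq_halfSpace (Or.inl rfl) hβ).comp πS).prod (√αS • πS))))

theorem undo_apply {β : ℝ} (hβ : 0 < β) (αS : ℝ) (f : H) : undo hβ αS f
    = H.mk (H.A f + expLift upper_eq_halfSpace (Or.inr rfl) hβ (H.S f))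
      (H.B f + expLift lower_eq_halfSpace (Or.inl rfl) hβ (H.S f)) (√αS • H.S f) := rfl

theorem H.inner_mk (a a' : L2 upper) (b b' : L2 lower) (s s' : L2 plane) :
    inner ℝ (H.mk a b s) (H.mk a' b' s') = inner ℝ a a' + (inner ℝ b b' + inner ℝ s s') := by
  rw [WithLp.prod_inner_apply, WithLp.prod_inner_apply]; rfl

theorem H.ext {f g : H} (hA : H.A f = H.A g) (hB : H.B f = H.B g) (hS : H.S f = H.S g) :
    f = g := by
  have : ∀ f : H, f = H.mk (H.A f) (H.B f) (H.S f) := fun _ => rfl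
  rw [this f, this g, hA, hB, hS]

theorem eq_zero_of_undo_eq_zero {β : ℝ} (hβ : 0 < β) {αS : ℝ} (hαS : 0 < αS) {f : H}
    (h : undo hβ αS f = 0) : f = 0 := by
  rw [undo_apply] at h
  have hS : √αS • H.S f = 0 := congrArg H.S h
  have hS' : H.S f = 0 := (smul_eq_zero.1 hS).resolve_left (Real.sqrt_ne_zero'.2 hαS)
  have hA : H.A f + expLift upper_eq_halfSpace (Or.inr rfl) hβ (H.S f) = 0 := congrArg H.A h
  have hB : H.B f + expLift lower_eq_halfSpace (Or.inl rfl) hβ (H.S f) = 0 := congrArg H.B h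
  rw [hS', map_zero, add_zero] at hA hB
  exact H.ext hA hB hS'

/-- Energy dissipation for the difference of two solutions. The factor `√αS` in `undo` weights the
interface energy by `αS`, which cancels the `1/αS` in `F₃`, so the interface fluxes match the
boundary terms from the two half spaces. -/
theorem inner_undo_sub_nonpos {κA κB κS αS β : ℝ} (hκA : 0 < κA) (hκB : 0 < κB) (hκS : 0 < κS)
    (hαS : 0 < αS) (hβ : 0 < β) {v w v' w' : H} (hv : MemDomL v) (hv' : MemDomL v')
    (hA : H.A (w + L κA κB κS v) =ᵐ[volume.restrict upper] F₁ κA β v w)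
    (hB : H.B (w + L κA κB κS v) =ᵐ[volume.restrict lower] F₂ κB β v w)
    (hS : H.S (w + L κA κB κS v) = F₃ κA κB αS β v)
    (hA' : H.A (w' + L κA κB κS v') =ᵐ[volume.restrict upper] F₁ κA β v' w')
    (hB' : H.B (w' + L κA κB κS v') =ᵐ[volume.restrict lower] F₂ κB β v' w')
    (hS' : H.S (w' + L κA κB κS v') = F₃ κA κB αS β v') :
    inner ℝ (undo hβ αS (v - v')) (undo hβ αS (w - w')) ≤ 0 := by
  have hνA : (-1 : ℝ) = 1 ∨ (-1 : ℝ) = -1 := Or.inr rfl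
  have hνB : (1 : ℝ) = 1 ∨ (1 : ℝ) = -1 := Or.inl rfl
  have bulkA : ∀ {v w : H}, H.A (w + L κA κB κS v) =ᵐ[volume.restrict upper] F₁ κA β v w →
      H.A w + expLift upper_eq_halfSpace hνA hβ (H.S w) = κA • (laplacian upper (H.A v)
        + expLift upper_eq_halfSpace hνA hβ (laplacian plane (H.S v) + β ^ 2 • H.S v)) := by
    intro v w h
    refine add_expLift_eq_of_ae _ _ _ (h.trans (Eventually.of_forall fun x => ?_))
    simp [F₁]
  have bulkB : ∀ {v w : H}, H.B (w + L κA κB κS v) =ᵐ[volume.restrict lower] F₂ κB β v w →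
      H.B w + expLift lower_eq_halfSpace hνB hβ (H.S w) = κB • (laplacian lower (H.B v)
        + expLift lower_eq_halfSpace hνB hβ (laplacian plane (H.S v) + β ^ 2 • H.S v)) := by
    intro v w h
    refine add_expLift_eq_of_ae _ _ _ (h.trans (Eventually.of_forall fun x => ?_))
    simp [F₂]
  have surf : ∀ {v w : H}, H.S (w + L κA κB κS v) = F₃ κA κB αS β v →
      H.S w = κS • laplacian plane (H.S v) + F₃ κA κB αS β v := by
    intro v w h
    rw [← h]
    change _ = _ + (H.S w + -(κS • laplacian plane (H.S v)))
    abel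
  have dA := (dirichletData_of_memW2 upper_eq_halfSpace hνA hv.1.1 hv.1.2).sub
    (dirichletData_of_memW2 upper_eq_halfSpace hνA hv'.1.1 hv'.1.2)
  have dB := (dirichletData_of_memW2 lower_eq_halfSpace hνB hv.2.1.1 hv.2.1.2).sub
    (dirichletData_of_memW2 lower_eq_halfSpace hνB hv'.2.1.1 hv'.2.1.2)
  have dS := (planeData_of_memW2 hv.2.2).sub (planeData_of_memW2 hv'.2.2)
  have iA := inner_laplacian_add_expLift_le upper_eq_halfSpace hνA hβ dA dS
  have iB := inner_laplacian_add_expLift_le lower_eq_halfSpace hνB hβ dB dS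
  have iS := dS.inner_nonpos
  have eA := congrArg₂ (· - ·) (bulkA hA) (bulkA hA')
  have eB := congrArg₂ (· - ·) (bulkB hB) (bulkB hB')
  have eS := congrArg₂ (· - ·) (surf hS) (surf hS')
  have sA : H.A (v - v') = H.A v - H.A v' := rfl
  have sB : H.B (v - v') = H.B v - H.B v' := rfl
  have sS : H.S (v - v') = H.S v - H.S v' := rfl
  have tA : H.A (w - w') = H.A w - H.A w' := rfl
  have tB : H.B (w - w') = H.B w - H.B w' := rfl
  have tS : H.S (w - w') = H.S w - H.S w' := rfl
  simp only [F₃] at eS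
  rw [undo_apply, undo_apply, H.inner_mk, sA, sB, sS, tA, tB, tS]
  set exA := expLift upper_eq_halfSpace hνA hβ
  set exB := expLift lower_eq_halfSpace hνB hβ
  set lA := laplacian upper (H.A v) - laplacian upper (H.A v') with hlA
  set lB := laplacian lower (H.B v) - laplacian lower (H.B v') with hlB
  set lS := laplacian plane (H.S v) - laplacian plane (H.S v') with hlS
  set τA := trace upper (weakPartial upper 2 (H.A v)) - trace upper (weakPartial upper 2 (H.A v'))
    with hτA
  set τB := trace lower (weakPartial lower 2 (H.B v)) - trace lower (weakPartial lower 2 (H.B v'))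
    with hτB
  have fA : H.A w - H.A w' + exA (H.S w - H.S w')
      = κA • (lA + exA (lS + β ^ 2 • (H.S v - H.S v'))) := by
    rw [map_sub, sub_add_sub_comm, eA, hlA, hlS, ← smul_sub, add_sub_add_comm, ← map_sub]
    congr 3
    rw [smul_sub]; abel
  have fB : H.B w - H.B w' + exB (H.S w - H.S w')
      = κB • (lB + exB (lS + β ^ 2 • (H.S v - H.S v'))) := by
    rw [map_sub, sub_add_sub_comm, eB, hlB, hlS, ← smul_sub, add_sub_add_comm, ← map_sub]
    congr 3
    rw [smul_sub]; abel
  have fS : H.S w - H.S w' = κS • lS + (κA / αS) • τA - (κB / αS) • τB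
      - (β / αS * (κA + κB)) • (H.S v - H.S v') := by
    rw [eS, hlS, hτA, hτB]
    simp only [smul_sub]
    abel
  rw [fA, fB, fS]
  set s := H.S v - H.S v'
  simp only [real_inner_smul_left, real_inner_smul_right, inner_add_right, inner_sub_right]
  -- The previous line also split the bulk products; this reassembles them in the form of `iA` and
  -- `iB`, while the interface terms, carrying scalar factors, stay expanded.
  simp only [← inner_add_right]
  rw [real_inner_comm] at iS
  rw [real_inner_comm, real_inner_comm s τA] at iA
  rw [real_inner_comm, real_inner_comm s τB] at iB
  have hsq : √αS * √αS = αS := Real.mul_self_sqrt hαS.le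
  have jA := mul_le_mul_of_nonneg_left iA hκA.le
  have jB := mul_le_mul_of_nonneg_left iB hκB.le
  have jS := mul_nonpos_of_nonneg_of_nonpos (mul_pos hαS hκS).le iS
  -- After multiplication by `αS`, the `τA`, `τB` and `β`-terms are the negatives of the upper
  -- bounds in `jA` and `jB`; only the nonpositive `jS` remains.
  have hexp : √αS * (√αS * (κS * inner ℝ s lS + κA / αS * inner ℝ s τA
      - κB / αS * inner ℝ s τB - β / αS * (κA + κB) * inner ℝ s s))
      = αS * κS * inner ℝ s lS + κA * inner ℝ s τA - κB * inner ℝ s τB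
        - β * (κA + κB) * inner ℝ s s := by
    rw [← mul_assoc, hsq]
    field_simp
  linarith

end TwoPhaseHeat

end

/-! ### Uniqueness of strong solutions -/

theorem lemma4p5 (κA κB κS αS β T : ℝ) (hκA : 0 < κA) (hκB : 0 < κB) (hκS : 0 < κS)
    (hαS : 0 < αS) (hβ : 0 < β) (hT : 0 < T) (v₀ : TwoPhaseHeat.H)
    (v_sharp v_flat : ℝ → TwoPhaseHeat.H)
    (h_sharp : TwoPhaseHeat.IsStrongSolution κA κB κS αS β T v₀ v_sharp)
    (h_flat : TwoPhaseHeat.IsStrongSolution κA κB κS αS β T v₀ v_flat) :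
    ∀ t ∈ Set.Ico 0 T, v_sharp t = v_flat t := by
  have hder : ∀ {v : ℝ → TwoPhaseHeat.H}, TwoPhaseHeat.IsStrongSolution κA κB κS αS β T v₀ v →
      IntegrableOn (TwoPhaseHeat.timeDeriv T v) (Ioo 0 T) ∧
      ∀ t ∈ Ico 0 T, v t = v₀ + ∫ s in (0 : ℝ)..t, TwoPhaseHeat.timeDeriv T v s := by
    intro v hv
    have hw : TwoPhaseHeat.HasL2TimeDeriv T v (TwoPhaseHeat.timeDeriv T v) := by
      rw [TwoPhaseHeat.timeDeriv, dif_pos hv.memX.exists_timeDeriv]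
      exact hv.memX.exists_timeDeriv.choose_spec
    have hint : IntegrableOn (TwoPhaseHeat.timeDeriv T v) (Ioo 0 T) :=
      hw.1.integrable one_le_two
    refine ⟨hint, fun t ht => ?_⟩
    rw [TwoPhaseHeat.eq_add_integral_of_weak_deriv hv.memX.continuousOn hint hw.2 ht, hv.initial]
  obtain ⟨int_sharp, eq_sharp⟩ := hder h_sharp
  obtain ⟨int_flat, eq_flat⟩ := hder h_flat
  set w := fun t => TwoPhaseHeat.timeDeriv T v_sharp t - TwoPhaseHeat.timeDeriv T v_flat t
    with hw
  have hii : ∀ {u : ℝ → TwoPhaseHeat.H}, IntegrableOn u (Ioo 0 T) → ∀ t ∈ Ico 0 T,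
      IntervalIntegrable u volume 0 t := fun hu t ht =>
    (intervalIntegrable_iff_integrableOn_Ioc_of_le ht.1).2
      (hu.mono_set fun r hr => ⟨hr.1, hr.2.trans_lt ht.2⟩)
  -- The common initial value cancels, so the difference is a primitive starting from zero.
  have hdiff : ∀ t ∈ Ico 0 T, v_sharp t - v_flat t = ∫ s in (0 : ℝ)..t, w s := by
    intro t ht
    rw [eq_sharp t ht, eq_flat t ht, add_sub_add_left_eq_sub,
      intervalIntegral.integral_sub (hii int_sharp t ht) (hii int_flat t ht)]
  have hwint : IntegrableOn w (Ioo 0 T) := int_sharp.sub int_flat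
  set J := TwoPhaseHeat.undo hβ αS
  -- A bounded linear map commutes with the integral, so the transformed difference is again a
  -- primitive starting from zero, now of `J ∘ w`.
  have hJ : ∀ t ∈ Ico 0 T, ∫ s in (0 : ℝ)..t, J (w s) = J (v_sharp t - v_flat t) := by
    intro t ht
    rw [hdiff t ht, J.intervalIntegral_comp_comm (hii hwint t ht)]
  have hae : ∀ᵐ t, t ∈ Ioo 0 T → inner ℝ (J (v_sharp t - v_flat t)) (J (w t)) ≤ 0 := by
    rw [← ae_restrict_iff' measurableSet_Ioo]
    filter_upwards [h_sharp.memX.mem_dom, h_flat.memX.mem_dom, h_sharp.equation, h_flat.equation]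
      with t d1 d2 e1 e2
    exact TwoPhaseHeat.inner_undo_sub_nonpos hκA hκB hκS hαS hβ d1 d2 e1.1 e1.2.1 e1.2.2
      e2.1 e2.2.1 e2.2.2
  intro b hb
  have hJint : IntervalIntegrable (fun t => J (w t)) volume 0 b :=
    ⟨J.integrable_comp (hii hwint b hb).1, J.integrable_comp (hii hwint b hb).2⟩
  have hzero := TwoPhaseHeat.integral_eq_zero_of_inner_nonpos hb.1 hJint (by
    filter_upwards [hae] with t ht htb
    have ht' : t ∈ Ioo 0 T := ⟨htb.1, htb.2.trans hb.2⟩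
    rw [hJ t ⟨ht'.1.le, ht'.2⟩]
    exact ht ht')
  rw [hJ b hb] at hzero
  exact sub_eq_zero.1 (TwoPhaseHeat.eq_zero_of_undo_eq_zero hβ hαS hzero)
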